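/- **Definitions.** Let $N\ge 1$. For a sequence $\mathbf x=(x_1,x_2,\dots)$ let $S_k(\mathbf x)$ be the Schur polynomials, $\sum_{k\ge0}S_k(\mathbf x)\lambda^k=\exp\big(\sum_{j\ge1}x_j\lambda^j\big)$. Let $\mathbf s=(s_1,s_2,\dots)$ be given by $\sum_{j\ge1}s_j\lambda^j=\ln\big[\tfrac2\lambda\tanh\tfrac\lambda2\big]$ (so $s_j=0$ for odd $j$). For complex parameters $\mathbf A=(a_3,a_5,\dots,a_{2N-1})$, real $x,y,t$ and $n\in\{0,1\}$ let $\mathbf x^{\pm}(n)=(x_1^\pm(n),0,x_3^\pm(n),0,\dots)$ with $$x_1^{\pm}(n)=x+6t\pm2iy\pm n,\qquad x_{2k+1}^{+}(n)=\frac{x+3t+2^{2k+1}iy+3^{2k+1}t}{(2k+1)!}+a_{2k+1},\qquad x_{2k+1}^{-}(n)=\frac{x+3t-2^{2k+1}iy+3^{2k+1}t}{(2k+1)!}+\overline{a_{2k+1}}\quad(k\ge1),$$ $$\tau^{(n)}_{i,j}=(-1)^n\sum_{\nu=0}^{\min(i,j)}4^{-\nu}S_{i-\nu}(\mathbf x^+(n)+\nu\mathbf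 s)\,S_{j-\nu}(\mathbf x^-(n)+\nu\mathbf s),\qquad \sigma_n(x,y,t;\mathbf A)=\det\big(\tau^{(n)}_{2i-1,2j-1}\big)_{1\le i,j\le N}.$$ (Only $a_3,\dots,a_{2N-1}$ occur in $\sigma_n$.) The $N$-th order lump solution of the KP equation is $$u_N(x,y,t;\mathbf A)=\left|\frac{\sigma_1(x-3t,y,t;\mathbf A)}{\sigma_0(x-3t,y,t;\mathbf A)}\right|^2-1 .$$ The Yablonskii–Vorob'ev polynomial is $Q_N^{[1]}(z)=c_N\det\big(p_{2i-j}(z)\big)_{1\le i,j\le N}$, where $c_N=\prod_{j=1}^N(2j-1)!!$, $\sum_{k\ge0}p_k(z)\lambda^k=\exp(z\lambda-\tfrac43\lambda^3)$ and $p_k=0$ for $k<0$. Cube roots of real numbers are real. **Proposition.** Let $N\ge1$ and $R>0$. (1) For every $\varepsilon>0$ there are $\kappa,T,M>0$, depending only on $N,R,\varepsilon$, such that $|u_N(x,y,t;\mathbf A)|\le\varepsilon$ whenever * $|t|\ge T$ and $|a_{2k+1}|^{3/(2k)}\le\kappa|t|$ for $1\le k\le N-1$ (that is, $|t|$ is large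 and $|t|\gg|a_{2k+1}|^{3/(2k)}$), * $\sqrt{(x+3t)^2+4y^2}\le R|t|^{1/3}$, * $\sqrt{(x-x_0)^2+4(y-y_0)^2}\ge M$ for each exceptional point $(x_0,y_0)$ given by $x_0+3t+2iy_0=(-3t)^{1/3}z_0$ with $z_0$ a nonzero root of $Q_N^{[1]}$, and * in the case $Q_N^{[1]}(0)=0$, also $\sqrt{(x+3t)^2+4y^2}\ge M$. In other words, in the region $\sqrt{(x+3t)^2+4y^2}=\mathcal O(|t|^{1/3})$ the solution $u_N$ decays to the zero background as $|t|\to\infty$, except at or near the points $(x_0,y_0)$ (and near the centre $(-3t,0)$ if $0$ is a root of $Q_N^{[1]}$). (2) There are $\kappa,T,K>0$, depending only on $N,R$, such that whenever $|t|\ge T$, $|a_{2k+1}|^{3/(2k)}\le\kappa|t|$ for $1\le k\le N-1$ and $\sqrt{(x+3t)^2+4y^2}\le R|t|^{1/3}$, then with $z$ defined by $x+3t+2iy=(-3t)^{1/3}z$ one has, for $n\in\{0,1\}$, $$\left|\sigma_n(x-3t,y,t;\mathbf A)-(-1)^{nN}\,2^{-N(N-1)}\,3^{N(N+1)/3}\,c_N^{-2}\,|t|^{N(N+1)/3}\,\big|Q_N^{[1]}(z)\big|^2\right|\le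 K\,|t|^{(N(N+1)-1)/3}.$$ -/

import Mathlib

namespace KPLump

noncomputable section

/-- The elementary Schur polynomial `S_k(x)` of a sequence `x = (x₁, x₂, …)` in a `ℚ`-algebra:
`∑_k S_k(x) λ^k = exp (∑_{j ≥ 1} x_j λ^j)` as formal power series in `λ`.
The entry `x 0` is not used. -/
def schur {A : Type*} [CommRing A] [Algebra ℚ A] (x : ℕ → A) (k : ℕ) : A :=
  PowerSeries.coeff k
    ((PowerSeries.exp A).subst (PowerSeries.mk fun j => if j = 0 then 0 else x j))

/-- The formal power series of `(2 / λ) tanh (λ / 2) = (2 (e^λ - 1) / λ) (e^λ + 1)⁻¹`;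
the series `(e^λ - 1) / λ` is `∑ λ^n / (n + 1)!`. -/
def tanhQuotient : PowerSeries ℝ :=
  2 * (PowerSeries.mk fun n => 1 / ((n + 1).factorial : ℝ)) * (PowerSeries.exp ℝ + 1)⁻¹

/-- The numbers `s_j` with `∑_{j ≥ 1} s_j λ^j = log ((2 / λ) tanh (λ / 2))`
(so `s_j = 0` for odd `j`); `PowerSeries.log` is the series of `log (1 + X)`. -/
def sCoeff (j : ℕ) : ℝ :=
  PowerSeries.coeff j ((PowerSeries.log ℝ).subst (tanhQuotient - 1))

/-- The sequence `x⁺(n) = (x₁⁺(n), 0, x₃⁺(n), 0, …)`, where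
`x₁⁺(n) = (x + 3t) + 2iy + 3t + n` and
`x_{2k+1}⁺(n) = ((x + 3t) + 2^{2k+1} i y + 3^{2k+1} t) / (2k+1)! + a_{2k+1}` for `k ≥ 1`.
Here `a k` stands for the parameter `a_{2k+1}`; `a 0` is not used (`a₁ = 0`). -/
def xPlus (n : ℕ) (x y t : ℝ) (a : ℕ → ℂ) (j : ℕ) : ℂ :=
  if Odd j then
    ((x + 3 * t : ℂ) + 2 ^ j * Complex.I * y + 3 ^ j * t) / (j.factorial : ℂ) +
      (if j = 1 then (n : ℂ) else a ((j - 1) / 2))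
  else 0

/-- The sequence `x⁻(n) = (x₁⁻(n), 0, x₃⁻(n), 0, …)`, where
`x₁⁻(n) = (x + 3t) - 2iy + 3t - n` and
`x_{2k+1}⁻(n) = ((x + 3t) - 2^{2k+1} i y + 3^{2k+1} t) / (2k+1)! + conj a_{2k+1}`
for `k ≥ 1`. -/
def xMinus (n : ℕ) (x y t : ℝ) (a : ℕ → ℂ) (j : ℕ) : ℂ :=
  if Odd j then
    ((x + 3 * t : ℂ) - 2 ^ j * Complex.I * y + 3 ^ j * t) / (j.factorial : ℂ) +
      (if j = 1 then -(n : ℂ) else (starRingEnd ℂ) (a ((j - 1) / 2)))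
  else 0

/-- `τ_{i,j}^{(n)} = (-1)^n ∑_{ν=0}^{min(i,j)} 4^{-ν} S_{i-ν}(x⁺(n) + ν s) S_{j-ν}(x⁻(n) + ν s)`. -/
def tau (n : ℕ) (x y t : ℝ) (a : ℕ → ℂ) (i j : ℕ) : ℂ :=
  (-1) ^ n * ∑ ν ∈ Finset.range (min i j + 1),
    1 / 4 ^ ν *
      schur (fun l => xPlus n x y t a l + (ν : ℂ) * (sCoeff l : ℂ)) (i - ν) *
      schur (fun l => xMinus n x y t a l + (ν : ℂ) * (sCoeff l : ℂ)) (j - ν)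

/-- `σ_n(x, y, t; a₃, …, a_{2N-1}) = det (τ_{2i-1,2j-1}^{(n)})_{1 ≤ i,j ≤ N}`. Only the values
`a k` with `1 ≤ k ≤ N - 1` occur in it. -/
def sigma (N n : ℕ) (x y t : ℝ) (a : ℕ → ℂ) : ℂ :=
  Matrix.det (Matrix.of fun i j : Fin N => tau n x y t a (2 * (i : ℕ) + 1) (2 * (j : ℕ) + 1))

/-- The `N`-th order lump solution
`u_N(x, y, t; a₃, …, a_{2N-1}) = |σ₁(x - 3t, y, t) / σ₀(x - 3t, y, t)|² - 1`. -/
def lump (N : ℕ) (x y t : ℝ) (a : ℕ → ℂ) : ℝ :=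
  ‖sigma N 1 (x - 3 * t) y t a / sigma N 0 (x - 3 * t) y t a‖ ^ 2 - 1

/-- The polynomials `p_k^{[m]}(z)`, with
`∑_k p_k^{[m]}(z) λ^k = exp (z λ - 2^{2m} / (2m+1) λ^{2m+1})` and `p_k^{[m]} = 0` for `k < 0`. -/
def yvSchur (m : ℕ) (k : ℤ) : Polynomial ℂ :=
  if k < 0 then 0
  else schur
    ((Pi.single 1 Polynomial.X : ℕ → Polynomial ℂ) -
      Pi.single (2 * m + 1) (Polynomial.C ((2 : ℂ) ^ (2 * m) / (2 * m + 1)))) k.toNat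

/-- `c_N = ∏_{j=1}^N (2j-1)!!`. -/
def yvConst (N : ℕ) : ℕ := ∏ j ∈ Finset.Icc 1 N, Nat.doubleFactorial (2 * j - 1)

/-- The Yablonskii-Vorob'ev polynomial
`Q_N^{[m]}(z) = c_N det (p_{2i-j}^{[m]}(z))_{1 ≤ i,j ≤ N}`. -/
def yvPoly (N m : ℕ) : Polynomial ℂ :=
  (yvConst N : Polynomial ℂ) *
    Matrix.det (Matrix.of fun i j : Fin N =>
      yvSchur m (2 * ((i : ℤ) + 1) - ((j : ℤ) + 1)))

/-- The real cube root. -/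
def cubeRoot (r : ℝ) : ℝ := Real.sign r * |r| ^ (1 / 3 : ℝ)

end

end KPLump

/-!
Set `μ = (-3t)^{1/3}`, so that `t = -μ³ / 3`, and `x + 3t + 2iy = μ z`. By weighted homogeneity
`S_k(x^±) = μ^k S_k(X^±)`, where the scaled times `X_j^± = μ^{-j} x_j^±` agree up to `O(1 / μ)`
with `(z, 0, -4/3, 0, …)`, respectively with the conjugate sequence. The hypothesis on `a_{2k+1}`
says that its contribution `μ^{-2k-1} a_{2k+1}` is of this order. Hence the scaled Schur
polynomials agree with the `p_k(z)` up to `O(1 / μ)`.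

The determinant `σ_n` is, up to powers of `μ`, the determinant of `∑_ν η^ν A_{iν} B_{jν}` with
`η = 1 / (4 μ²)`. Expanding by multilinearity (`det_eq_leading_add`), the lowest power of `η` carries
`det (A_{iν}) det (B_{jν})` over `ν < N`, which is close to `|q(z)|²`, where `q = Q_N / c_N` is the
Wronskian of `p₁, p₃, …, p_{2N-1}`. Each of the two factors has an error `O(1 / μ)` and the other
terms are `O(1 / μ²)`, so the scaled determinant is `|q|² + O(|q| / μ + 1 / μ²)`
(`ScaledParam.sigmaHat_sub_isBigO`). This gives the leading term of `σ_n`. It also gives the decay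
of `u_N`, once `|q(z)|` is at least a large multiple of `1 / |μ|` at distance `M / |μ|` from the
roots of `q`; and this holds because the roots of `q` are simple (`exists_mul_le_norm_eval`).

The simplicity of the roots (`derivative_yvDet_eval_ne_zero`) is seen on the space `V` spanned by
`p₁, p₃, …, p_{2N-1}`. It is stable under `∂²`, because `p_k' = p_{k-1}`, and under `z ∂ - 4 ∂³`,
of which the `p_k` are eigenvectors. So the set `E` of orders of vanishing at a point `α` of
elements of `V` is closed under subtracting `2` and `3`, as long as the result is not negative.
Since `E` has at most `N` elements, it is contained in `{0, …, N - 1}` or in `{0, …, N - 2, N}`.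
If `q(α) = 0`, then some element of `V` has order at least `N`; if moreover `q'(α) = 0`, then
a nonzero element has order at least `N - 1` but not `N` (`q'` is the Wronskian with the last column
differentiated once more). The two conditions contradict each other.
-/

namespace KPLump

open Polynomial Matrix Asymptotics Filter
open scoped ComplexConjugate

/-! ### Elementary Schur polynomials -/

theorem hasSubst_mk {A : Type*} [CommRing A] (x : ℕ → A) :
    PowerSeries.HasSubst (PowerSeries.mk fun j => if j = 0 then (0 : A) else x j) :=
  PowerSeries.HasSubst.of_constantCoeff_zero'
    (by simp [← PowerSeries.coeff_zero_eq_constantCoeff_apply])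

section Schur

variable {A : Type*} [CommRing A] [Algebra ℚ A]

theorem schur_zero (x : ℕ → A) : schur x 0 = 1 := by
  have h0 :
      PowerSeries.constantCoeff (PowerSeries.mk fun j => if j = 0 then (0 : A) else x j) = 0 := by
    simp [← PowerSeries.coeff_zero_eq_constantCoeff_apply]
  unfold schur
  rw [PowerSeries.coeff_subst' (hasSubst_mk x), finsum_eq_single _ 0]
  · simp
  · intro n hn
    simp [map_pow, h0, hn]

/-- The coefficients of `E = exp g` satisfy the recursion expressed by `E' = g' E`. -/
theorem succ_mul_schur_succ (x : ℕ → A) (k : ℕ) :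
    ((k : A) + 1) * schur x (k + 1) =
      ∑ j ∈ Finset.range (k + 1), ((j : A) + 1) * x (j + 1) * schur x (k - j) := by
  have h := congrArg (PowerSeries.coeff k)
    (PowerSeries.derivative_subst (f := PowerSeries.exp A) (hasSubst_mk x))
  rw [PowerSeries.derivative_exp, PowerSeries.coeff_derivative, mul_comm (PowerSeries.subst _ _),
    PowerSeries.coeff_mul, Finset.Nat.sum_antidiagonal_eq_sum_range_succ_mk] at h
  simp only [PowerSeries.coeff_derivative, PowerSeries.coeff_mk, Nat.succ_ne_zero, if_false] at h
  rw [mul_comm]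
  unfold schur
  rw [h]
  exact Finset.sum_congr rfl fun j _ => by ring

variable [IsDomain A] [CharZero A]

/-- A sequence satisfying the recursion of the Schur polynomials consists of Schur polynomials. -/
theorem schur_unique (x f : ℕ → A) (h0 : f 0 = 1)
    (h : ∀ k : ℕ, ((k : A) + 1) * f (k + 1) =
      ∑ j ∈ Finset.range (k + 1), ((j : A) + 1) * x (j + 1) * f (k - j)) (k : ℕ) :
    f k = schur x k := by
  induction k using Nat.strong_induction_on with
  | _ k ih =>
    cases k with
    | zero => rw [h0, schur_zero]
    | succ k =>
      have hk : (k : A) + 1 ≠ 0 := by exact_mod_cast Nat.succ_ne_zero k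
      apply mul_left_cancel₀ hk
      rw [h, succ_mul_schur_succ]
      refine Finset.sum_congr rfl fun j _ => ?_
      rw [ih (k - j) (by omega)]

/-- Weighted homogeneity of the Schur polynomials. -/
theorem schur_pow_mul (c : A) (x : ℕ → A) (k : ℕ) :
    schur (fun j => c ^ j * x j) k = c ^ k * schur x k := by
  refine (schur_unique _ (fun k => c ^ k * schur x k) (by simp [schur_zero])
    (fun k : ℕ => ?_) k).symm
  have := congrArg (c ^ (k + 1) * ·) (succ_mul_schur_succ x k)
  simp only [Finset.mul_sum] at this
  rw [mul_left_comm, this]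
  refine Finset.sum_congr rfl fun j hj => ?_
  have : k + 1 = (j + 1) + (k - j) := by
    have := Finset.mem_range.1 hj
    omega
  rw [this, pow_add]
  ring

end Schur

theorem map_schur {A B : Type*} [CommRing A] [Algebra ℚ A] [CommRing B] [Algebra ℚ B]
    [IsDomain B] [CharZero B] (φ : A →+* B) (x : ℕ → A) (k : ℕ) :
    φ (schur x k) = schur (fun j => φ (x j)) k := by
  refine schur_unique _ (fun k => φ (schur x k)) (by simp [schur_zero]) (fun k : ℕ => ?_) k
  have := congrArg φ (succ_mul_schur_succ x k)
  simpa using this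

/-! ### The polynomials `p_k` -/

/-- The sequence `(z, 0, -4/3, 0, …)`, whose Schur polynomials are the `p_k(z)`. -/
noncomputable def yvSeq {A : Type*} [CommRing A] [Algebra ℂ A] (z : A) (j : ℕ) : A :=
  if j = 1 then z else if j = 3 then algebraMap ℂ A (-(4 / 3)) else 0

theorem yvSchur_natCast (k : ℕ) : yvSchur 1 k = schur (yvSeq X) k := by
  rw [yvSchur, if_neg (by omega), Int.toNat_natCast]
  congr 1
  funext j
  by_cases h1 : j = 1
  · simp [yvSeq, h1]
  · by_cases h3 : j = 3
    · simp [yvSeq, h3]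
      norm_num
    · simp [yvSeq, h1, h3]

theorem yvSchur_zero : yvSchur 1 0 = 1 := by
  simp [yvSchur, schur_zero]

theorem yvSchur_of_neg {k : ℤ} (hk : k < 0) : yvSchur 1 k = 0 := by
  simp [yvSchur, hk]

theorem eval_yvSchur (z : ℂ) (k : ℕ) : (yvSchur 1 k).eval z = schur (yvSeq z) k := by
  rw [yvSchur_natCast, ← coe_evalRingHom, map_schur]
  congr 1
  funext j
  simp only [yvSeq, coe_evalRingHom]
  split_ifs <;> simp

/-- The logarithmic derivative of the generating function `exp (z λ - 4 / 3 λ ^ 3)`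
is `z - 4 λ ^ 2`. -/
theorem mul_yvSchur (k : ℤ) :
    (k : ℂ[X]) * yvSchur 1 k = X * yvSchur 1 (k - 1) - 4 * yvSchur 1 (k - 3) := by
  rcases lt_trichotomy k 0 with hk | rfl | hk
  · rw [yvSchur_of_neg hk, yvSchur_of_neg (by omega), yvSchur_of_neg (by omega)]
    simp
  · rw [yvSchur_of_neg (k := 0 - 1) (by omega), yvSchur_of_neg (k := 0 - 3) (by omega)]
    simp
  · obtain ⟨n, rfl⟩ : ∃ n : ℕ, k = n + 1 := ⟨(k - 1).toNat, by omega⟩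
    have key := succ_mul_schur_succ (yvSeq (X : ℂ[X])) n
    have h4 : (C (4 / 3) : ℂ[X]) * 3 = 4 := by
      rw [← map_ofNat (C : ℂ →+* ℂ[X]) 3, ← C_mul, ← map_ofNat (C : ℂ →+* ℂ[X]) 4]
      norm_num
    rw [show (n : ℤ) + 1 - 1 = (n : ℕ) by ring, show (n : ℤ) + 1 = ((n + 1 : ℕ) : ℤ) by simp,
      yvSchur_natCast, yvSchur_natCast, Int.cast_natCast]
    push_cast
    rw [key]
    rcases lt_or_ge n 2 with hn | hn
    · rw [yvSchur_of_neg (by omega)]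
      interval_cases n <;> simp [Finset.sum_range_succ, yvSeq]
    · rw [show (n : ℤ) + 1 - 3 = ((n - 2 : ℕ) : ℤ) by omega, yvSchur_natCast,
        Finset.sum_eq_add_of_mem 0 2 (by simp) (by simp; omega) (by norm_num)]
      · simp [yvSeq]
        norm_num
        linear_combination (-schur (yvSeq (X : ℂ[X])) (n - 2)) * h4
      · rintro j - ⟨h0, h2⟩
        simp [yvSeq, h0, h2]

theorem derivative_yvSchur (k : ℤ) : derivative (yvSchur 1 k) = yvSchur 1 (k - 1) := by
  rcases le_or_gt k 0 with hk | hk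
  · rcases hk.lt_or_eq with hk | rfl
    · rw [yvSchur_of_neg hk, yvSchur_of_neg (by omega), derivative_zero]
    · rw [yvSchur_zero, yvSchur_of_neg (k := 0 - 1) (by omega), derivative_one]
  · obtain ⟨n, rfl⟩ : ∃ n : ℕ, k = n + 1 := ⟨(k - 1).toNat, by omega⟩
    induction n using Nat.strong_induction_on with
    | _ n ih =>
      have ih' : ∀ j : ℤ, j < n + 1 → derivative (yvSchur 1 j) = yvSchur 1 (j - 1) := by
        intro j hj
        rcases lt_trichotomy j 0 with hk | rfl | hk
        · rw [yvSchur_of_neg hk, yvSchur_of_neg (by omega), derivative_zero]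
        · rw [yvSchur_zero, yvSchur_of_neg (k := 0 - 1) (by omega), derivative_one]
        · obtain ⟨m, rfl⟩ : ∃ m : ℕ, j = m + 1 := ⟨(j - 1).toNat, by omega⟩
          exact ih m (by omega) (by omega)
      have hn : (((n : ℤ) + 1 : ℤ) : ℂ[X]) ≠ 0 := by exact_mod_cast Nat.succ_ne_zero n
      apply mul_left_cancel₀ hn
      have h1 := congrArg derivative (mul_yvSchur ((n : ℤ) + 1))
      have h2 := mul_yvSchur ((n : ℤ) + 1 - 1)
      simp only [derivative_mul, derivative_sub, derivative_X, derivative_intCast,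
        derivative_ofNat] at h1
      rw [ih' ((n : ℤ) + 1 - 1) (by omega), ih' ((n : ℤ) + 1 - 3) (by omega)] at h1
      have e : (n : ℤ) + 1 - 1 - 3 = n + 1 - 3 - 1 := by ring
      rw [e] at h2
      push_cast at h1 h2 ⊢
      linear_combination h1 - h2

theorem iterate_derivative_yvSchur (j : ℕ) (k : ℤ) :
    derivative^[j] (yvSchur 1 k) = yvSchur 1 (k - j) := by
  induction j generalizing k with
  | zero => simp
  | succ j ih =>
    rw [Function.iterate_succ_apply, derivative_yvSchur, ih]
    congr 1
    push_cast
    ring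

theorem yvSchur_ne_zero (k : ℕ) : yvSchur 1 k ≠ 0 := by
  intro h
  have := iterate_derivative_yvSchur k k
  rw [h, sub_self, yvSchur_zero] at this
  simp at this

/-- The operator `z ∂ - 4 ∂³`, of which the polynomials `p_k` are eigenvectors. -/
noncomputable def eulerOp : ℂ[X] →ₗ[ℂ] ℂ[X] where
  toFun f := X * derivative f - 4 * derivative (derivative (derivative f))
  map_add' f g := by simp only [derivative_add]; ring
  map_smul' c f := by simp only [smul_eq_C_mul, RingHom.id_apply, derivative_C_mul]; ring

theorem eulerOp_yvSchur (k : ℤ) : eulerOp (yvSchur 1 k) = (k : ℂ) • yvSchur 1 k := by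
  have h := mul_yvSchur k
  simp only [eulerOp, LinearMap.coe_mk, AddHom.coe_mk, derivative_yvSchur]
  rw [show k - 1 - 1 - 1 = k - 3 by ring, smul_eq_C_mul, ← h]
  simp

theorem linearIndependent_yvSchur (N : ℕ) :
    LinearIndependent ℂ fun i : Fin N => yvSchur 1 (2 * (i : ℕ) + 1 : ℕ) := by
  refine Module.End.eigenvectors_linearIndependent' eulerOp
    (fun i : Fin N => ((2 * (i : ℕ) + 1 : ℕ) : ℂ)) (fun i j h => ?_) _
    fun i => ⟨?_, yvSchur_ne_zero _⟩
  · have := Nat.cast_injective h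
    exact Fin.ext (by omega)
  · rw [Module.End.mem_eigenspace_iff]
    simpa using eulerOp_yvSchur (2 * (i : ℕ) + 1 : ℕ)

/-! ### Vanishing orders in a space of polynomials -/

/-- Some element of `V` vanishes at `α` to order exactly `e`. -/
def IsVanishingOrder (V : Submodule ℂ ℂ[X]) (α : ℂ) (e : ℕ) : Prop :=
  ∃ f ∈ V, (∀ j < e, (derivative^[j] f).eval α = 0) ∧ (derivative^[e] f).eval α ≠ 0

theorem exists_order {f : ℂ[X]} (hf : f ≠ 0) (α : ℂ) :
    ∃ e, (∀ j < e, (derivative^[j] f).eval α = 0) ∧ (derivative^[e] f).eval α ≠ 0 := by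
  classical
  have h : ∃ e, (derivative^[e] f).eval α ≠ 0 := by
    by_contra! h
    exact lt_irrefl _ ((lt_rootMultiplicity_iff_isRoot_iterate_derivative hf).2
      fun m _ => h m)
  exact ⟨Nat.find h, fun j hj => not_not.1 (Nat.find_min h hj), Nat.find_spec h⟩

/-- Elements of different orders of vanishing are linearly independent. -/
theorem card_le_finrank_of_isVanishingOrder {V : Submodule ℂ ℂ[X]} [FiniteDimensional ℂ V] {α : ℂ}
    (S : Finset ℕ) (hS : ∀ e ∈ S, IsVanishingOrder V α e) : S.card ≤ Module.finrank ℂ V := by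
  choose! g hgV hg0 hg1 using hS
  have hli : LinearIndependent ℂ fun e : S => (⟨g e, hgV e e.2⟩ : V) := by
    rw [Fintype.linearIndependent_iff]
    intro c hc
    have hc' : ∑ e : S, c e • g e = 0 := by
      simpa using congrArg Subtype.val hc
    have key : ∀ n (hn : n ∈ S), c ⟨n, hn⟩ = 0 := by
      intro n
      induction n using Nat.strong_induction_on with
      | _ n ih =>
        intro hn
        have h := congrArg (fun f => (derivative^[n] f).eval α) hc'
        simp only [iterate_derivative_sum, eval_finsetSum, iterate_derivative_smul,
          iterate_derivative_zero, eval_zero, eval_smul, smul_eq_mul] at h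
        rw [Finset.sum_eq_single ⟨n, hn⟩] at h
        · exact (mul_eq_zero.1 h).resolve_right (hg1 n hn)
        · rintro ⟨e, he⟩ - hne
          rcases lt_or_gt_of_ne (fun h => hne (Subtype.ext h) : e ≠ n) with hlt | hgt
          · rw [ih e hlt he, zero_mul]
          · rw [hg0 e he n hgt, mul_zero]
        · simp
    exact fun i => key i i.2
  simpa using hli.fintype_card_le_finrank

section Stable

variable {V : Submodule ℂ ℂ[X]} {α : ℂ}

theorem IsVanishingOrder.of_add_two (h2 : ∀ f ∈ V, derivative (derivative f) ∈ V) {e : ℕ}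
    (h : IsVanishingOrder V α (e + 2)) : IsVanishingOrder V α e := by
  obtain ⟨f, hf, h0, h1⟩ := h
  exact ⟨_, h2 f hf, fun j hj => h0 (j + 2) (by omega), h1⟩

theorem IsVanishingOrder.of_add_three (h3 : ∀ f ∈ V, eulerOp f ∈ V) {e : ℕ}
    (h : IsVanishingOrder V α (e + 3)) : IsVanishingOrder V α e := by
  obtain ⟨f, hf, h0, h1⟩ := h
  have key : ∀ j ≤ e, (derivative^[j] (eulerOp f)).eval α =
      -4 * (derivative^[j + 3] f).eval α := by
    intro j hj
    have e1 : derivative^[j] (X * derivative f) =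
        X * derivative^[j + 1] f + (j : ℂ[X]) * derivative^[j] f := by
      clear hj
      induction j with
      | zero => simp
      | succ j ih =>
        rw [Function.iterate_succ_apply', ih]
        simp only [derivative_add, derivative_mul, derivative_X, derivative_natCast,
          Function.iterate_succ_apply']
        push_cast
        ring
    have e2 : derivative^[j] (4 * derivative (derivative (derivative f))) =
        4 * derivative^[j + 3] f := by
      rw [← map_ofNat (C : ℂ →+* ℂ[X]) 4, ← smul_eq_C_mul, ← smul_eq_C_mul, iterate_derivative_smul]
      rfl
    simp only [eulerOp, LinearMap.coe_mk, AddHom.coe_mk]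
    rw [iterate_derivative_sub, e1, e2]
    simp only [eval_sub, eval_add, eval_mul, eval_natCast, eval_X, eval_ofNat]
    rw [h0 (j + 1) (by omega), h0 j (by omega)]
    ring
  refine ⟨_, h3 f hf, fun j hj => ?_, ?_⟩
  · rw [key j hj.le, h0 _ (by omega), mul_zero]
  · rw [key e le_rfl]
    exact mul_ne_zero (by norm_num) h1

/-- Every natural number except `1` is a sum of twos and threes. -/
theorem IsVanishingOrder.of_le (h2 : ∀ f ∈ V, derivative (derivative f) ∈ V)
    (h3 : ∀ f ∈ V, eulerOp f ∈ V) {e : ℕ} (h : IsVanishingOrder V α e) {j : ℕ} (hj : j ≤ e)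
    (hj' : j + 1 ≠ e) : IsVanishingOrder V α j := by
  induction e using Nat.strong_induction_on generalizing j with
  | _ e ih =>
    rcases hj.eq_or_lt with rfl | hlt
    · exact h
    · obtain ⟨d, rfl⟩ : ∃ d, e = d + 2 := ⟨e - 2, by omega⟩
      by_cases hd : j + 1 = d
      · subst hd
        exact h.of_add_three h3
      · exact ih d (by omega) (h.of_add_two h2) (by omega) hd

/-- In a space of dimension at most `N` stable under `∂²` and `z ∂ - 4 ∂³`, all vanishing
orders at a point lie in `{0, …, N - 1}`, or all lie in `{0, …, N - 2, N}`. -/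
theorem no_common_vanishing [FiniteDimensional ℂ V] {N : ℕ} (hN : 1 ≤ N)
    (hV : Module.finrank ℂ V ≤ N) (h2 : ∀ f ∈ V, derivative (derivative f) ∈ V)
    (h3 : ∀ f ∈ V, eulerOp f ∈ V) {f g : ℂ[X]} (hf : f ∈ V) (hf0 : f ≠ 0) (hg : g ∈ V) (hg0 : g ≠ 0)
    (hfα : ∀ j < N, (derivative^[j] f).eval α = 0)
    (hgα : ∀ j < N - 1, (derivative^[j] g).eval α = 0) (hgN : (derivative^[N] g).eval α = 0) :
    False := by
  -- An order `e > N` forces the `e` orders `0, …, e - 2, e`.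
  have large : ∀ e, IsVanishingOrder V α e → e ≤ N := by
    intro e he
    by_contra! hlt
    have hc := card_le_finrank_of_isVanishingOrder (V := V) (α := α)
      (insert e (Finset.range (e - 1))) (by
        intro j hj
        rcases Finset.mem_insert.1 hj with rfl | hj
        · exact he
        · have := Finset.mem_range.1 hj
          exact he.of_le h2 h3 (by omega) (by omega))
    rw [Finset.card_insert_of_notMem (by simp), Finset.card_range] at hc
    omega
  obtain ⟨d, hd0, hd1⟩ := exists_order hf0 α
  obtain ⟨e, he0, he1⟩ := exists_order hg0 α
  have hd : IsVanishingOrder V α d := ⟨f, hf, hd0, hd1⟩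
  have he : IsVanishingOrder V α e := ⟨g, hg, he0, he1⟩
  have hdN : N ≤ d := by
    by_contra! h
    exact hd1 (hfα d h)
  have heN : N - 1 ≤ e := by
    by_contra! h
    exact he1 (hgα e h)
  have heN' : e ≠ N := by
    rintro rfl
    exact he1 hgN
  obtain rfl : d = N := le_antisymm (large d hd) hdN
  obtain rfl : e = d - 1 := by have := large e he; omega
  have hc := card_le_finrank_of_isVanishingOrder (V := V) (α := α) (Finset.range (d + 1)) (by
    intro j hj
    have := Finset.mem_range.1 hj
    by_cases hj' : j + 1 = d
    · obtain rfl : j = d - 1 := by omega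
      exact he
    · exact hd.of_le h2 h3 (by omega) hj')
  rw [Finset.card_range] at hc
  omega

end Stable

/-! ### Simplicity of the roots of the Yablonskii-Vorob'ev polynomials -/

theorem derivative_det {n R : Type*} [Fintype n] [DecidableEq n] [CommRing R]
    (M : Matrix n n R[X]) :
    derivative M.det = ∑ j, (M.updateCol j fun i => derivative (M i j)).det := by
  simp only [det_apply, derivative_sum, derivative_smul, derivative_prod_finset]
  rw [Finset.sum_comm]
  simp only [Finset.smul_sum]
  refine Finset.sum_congr rfl fun σ _ => Finset.sum_congr rfl fun j _ => ?_
  rw [← Finset.prod_erase_mul Finset.univ _ (Finset.mem_univ j)]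
  congr 2
  · refine Finset.prod_congr rfl fun i hi => ?_
    rw [updateCol_ne (Finset.ne_of_mem_erase hi)]
  · simp

/-- The Wronskian of `p₁, p₃, …, p_{2N-1}`. -/
noncomputable def yvDet (N : ℕ) : ℂ[X] :=
  det (of fun i j : Fin N => yvSchur 1 (2 * ((i : ℤ) + 1) - ((j : ℤ) + 1)))

theorem yvPoly_eq (N : ℕ) : yvPoly N 1 = (yvConst N : ℂ[X]) * yvDet N := rfl

theorem yvConst_ne_zero (N : ℕ) : yvConst N ≠ 0 :=
  Finset.prod_ne_zero_iff.2 fun _ _ => (Nat.doubleFactorial_pos _).ne'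

/-- If a determinant whose columns are values at `α` of derivatives of `p₁, p₃, …, p_{2N-1}`
vanishes, then these derivatives of some nonzero combination of the `p_{2i-1}` vanish at `α`. -/
theorem exists_combination {N : ℕ} {α : ℂ} (o : Fin N → ℕ)
    (h : det (of fun i j : Fin N =>
      (derivative^[o j] (yvSchur 1 (2 * (i : ℕ) + 1 : ℕ))).eval α) = 0) :
    ∃ f ∈ Submodule.span ℂ (Set.range fun i : Fin N => yvSchur 1 (2 * (i : ℕ) + 1 : ℕ)),
      f ≠ 0 ∧ ∀ j, (derivative^[o j] f).eval α = 0 := by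
  obtain ⟨v, hv, hvM⟩ := exists_vecMul_eq_zero_iff.2 h
  refine ⟨∑ i, v i • yvSchur 1 (2 * (i : ℕ) + 1 : ℕ), ?_, ?_, fun j => ?_⟩
  · exact Submodule.sum_mem _ fun i _ => Submodule.smul_mem _ _ (Submodule.subset_span ⟨i, rfl⟩)
  · intro h0
    exact hv (funext (Fintype.linearIndependent_iff.1 (linearIndependent_yvSchur N) v h0))
  · have := congrFun hvM j
    simpa [iterate_derivative_sum, eval_finsetSum, vecMul, dotProduct, iterate_derivative_smul]
      using this

theorem yvDet_eval_eq (N : ℕ) (α : ℂ) : (yvDet N).eval α =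
    det (of fun i j : Fin N => (derivative^[(j : ℕ)] (yvSchur 1 (2 * (i : ℕ) + 1 : ℕ))).eval α) := by
  rw [yvDet, ← coe_evalRingHom, RingHom.map_det]
  congr 1
  ext i j
  simp only [RingHom.mapMatrix_apply, map_apply, of_apply, iterate_derivative_yvSchur,
    coe_evalRingHom]
  congr 2
  push_cast
  ring

/-- Differentiating any column but the last reproduces the next column. -/
theorem derivative_yvDet_eval_eq (n : ℕ) (α : ℂ) : (derivative (yvDet (n + 1))).eval α =
    det (of fun i j : Fin (n + 1) =>
      (derivative^[if j = Fin.last n then n + 1 else (j : ℕ)]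
        (yvSchur 1 (2 * (i : ℕ) + 1 : ℕ))).eval α) := by
  rw [yvDet, derivative_det, Finset.sum_eq_single (Fin.last n)]
  · rw [← coe_evalRingHom, RingHom.map_det]
    congr 1
    ext i j
    simp only [RingHom.mapMatrix_apply, map_apply, of_apply, iterate_derivative_yvSchur,
      coe_evalRingHom, updateCol_apply, derivative_yvSchur]
    split_ifs with h
    · congr 2
      simp
      ring
    · congr 2
      push_cast
      ring
  · intro j _ hj
    have hj' : (j : ℕ) < n := by
      have := Fin.val_lt_last hj
      simpa using this
    have hne : j ≠ ⟨j + 1, by omega⟩ := fun h => by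
      have := congrArg Fin.val h
      simp at this
    refine det_zero_of_column_eq hne fun i => ?_
    rw [updateCol_self, updateCol_ne hne.symm, of_apply, of_apply, derivative_yvSchur]
    congr 1
    push_cast
    ring
  · simp

/-- The roots of `Q_N` are simple. -/
theorem derivative_yvDet_eval_ne_zero {N : ℕ} (hN : 1 ≤ N) {α : ℂ} (h : (yvDet N).eval α = 0) :
    (derivative (yvDet N)).eval α ≠ 0 := by
  intro h'
  obtain ⟨n, rfl⟩ : ∃ n, N = n + 1 := ⟨N - 1, by omega⟩
  rw [yvDet_eval_eq] at h
  rw [derivative_yvDet_eval_eq] at h'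
  obtain ⟨f, hf, hf0, hfα⟩ := exists_combination _ h
  obtain ⟨g, hg, hg0, hgα⟩ := exists_combination _ h'
  have : FiniteDimensional ℂ (Submodule.span ℂ
      (Set.range fun i : Fin (n + 1) => yvSchur 1 (2 * (i : ℕ) + 1 : ℕ))) :=
    FiniteDimensional.span_of_finite ℂ (Set.finite_range _)
  have stable : ∀ T : ℂ[X] →ₗ[ℂ] ℂ[X], (∀ i : Fin (n + 1), T (yvSchur 1 (2 * (i : ℕ) + 1 : ℕ)) ∈
      Submodule.span ℂ (Set.range fun i : Fin (n + 1) => yvSchur 1 (2 * (i : ℕ) + 1 : ℕ))) →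
      ∀ f ∈ Submodule.span ℂ (Set.range fun i : Fin (n + 1) => yvSchur 1 (2 * (i : ℕ) + 1 : ℕ)),
      T f ∈ Submodule.span ℂ (Set.range fun i : Fin (n + 1) => yvSchur 1 (2 * (i : ℕ) + 1 : ℕ)) := by
    intro T hT f hf
    induction hf using Submodule.span_induction with
    | mem x hx =>
      obtain ⟨i, rfl⟩ := hx
      exact hT i
    | zero => simp
    | add x y _ _ hx hy => rw [map_add]; exact Submodule.add_mem _ hx hy
    | smul c x _ hx => rw [map_smul]; exact Submodule.smul_mem _ _ hx
  refine no_common_vanishing (α := α) (N := n + 1) hN ?_ (stable (derivative ∘ₗ derivative) ?_)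
    (stable eulerOp ?_) hf hf0 hg hg0 (fun j hj => ?_) (fun j hj => ?_) ?_
  · simpa [Set.finrank] using finrank_range_le_card (R := ℂ)
      (fun i : Fin (n + 1) => yvSchur 1 (2 * (i : ℕ) + 1 : ℕ))
  · rintro ⟨i, hi⟩
    have e : (derivative ∘ₗ derivative) (yvSchur 1 (2 * i + 1 : ℕ)) =
        yvSchur 1 (2 * (i : ℤ) - 1) := by
      simp only [LinearMap.comp_apply, derivative_yvSchur]
      congr 1
      push_cast
      ring
    rw [e]
    rcases i with _ | i
    · rw [yvSchur_of_neg (by simp)]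
      exact Submodule.zero_mem _
    · exact Submodule.subset_span ⟨⟨i, by omega⟩, congrArg (yvSchur 1) (by push_cast; ring)⟩
  · intro i
    rw [eulerOp_yvSchur]
    exact Submodule.smul_mem _ _ (Submodule.subset_span ⟨i, rfl⟩)
  · exact hfα ⟨j, hj⟩
  · have := hgα ⟨j, by omega⟩
    rwa [if_neg (fun h => by have := congrArg Fin.val h; simp at this; omega)] at this
  · simpa using hgα (Fin.last n)

/-! ### Approximation up to `O(δ)` -/

section Approx

variable {Ω : Type*} {l : Filter Ω} {δ : Ω → ℝ}

/-- The function `b` is bounded along `l`, and `a` agrees with it up to `O(δ)`. -/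
def Approx (l : Filter Ω) (δ : Ω → ℝ) (a b : Ω → ℂ) : Prop :=
  (fun ω => a ω - b ω) =O[l] δ ∧ b =O[l] (fun _ => (1 : ℝ))

namespace Approx

variable {a b c d : Ω → ℂ}

theorem refl (h : b =O[l] (fun _ => (1 : ℝ))) : Approx l δ b b :=
  ⟨by simpa using isBigO_zero _ _, h⟩

theorem const (c : ℂ) : Approx l δ (fun _ => c) fun _ => c :=
  refl (isBigO_const_const _ one_ne_zero _)

theorem left_isBigO (hδ : δ =O[l] (fun _ => (1 : ℝ))) (h : Approx l δ a b) :
    a =O[l] (fun _ => (1 : ℝ)) := by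
  simpa using (h.1.trans hδ).add h.2

theorem mul (hδ : δ =O[l] (fun _ => (1 : ℝ))) (h : Approx l δ a b) (h' : Approx l δ c d) :
    Approx l δ (fun ω => a ω * c ω) fun ω => b ω * d ω := by
  refine ⟨?_, by simpa using h.2.mul h'.2⟩
  have h1 := (h.1.mul (h'.left_isBigO hδ)).add
    ((h.2.mul h'.1).trans (by simpa using isBigO_refl δ l))
  refine (h1.congr_left fun ω => ?_).trans (by simpa using isBigO_refl δ l)
  ring

theorem sum {ι : Type*} {s : Finset ι} {f g : ι → Ω → ℂ} (h : ∀ i ∈ s, Approx l δ (f i) (g i)) :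
    Approx l δ (fun ω => ∑ i ∈ s, f i ω) fun ω => ∑ i ∈ s, g i ω :=
  ⟨by simpa only [Finset.sum_sub_distrib] using IsBigO.fun_sum fun i hi => (h i hi).1,
    IsBigO.fun_sum fun i hi => (h i hi).2⟩

theorem prod (hδ : δ =O[l] (fun _ => (1 : ℝ))) {ι : Type*} {s : Finset ι} {f g : ι → Ω → ℂ}
    (h : ∀ i ∈ s, Approx l δ (f i) (g i)) :
    Approx l δ (fun ω => ∏ i ∈ s, f i ω) fun ω => ∏ i ∈ s, g i ω := by
  classical
  induction s using Finset.induction_on with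
  | empty => simpa using const 1
  | insert i s hi ih =>
    simp only [Finset.prod_insert hi]
    exact (h i (Finset.mem_insert_self i s)).mul hδ
      (ih fun j hj => h j (Finset.mem_insert_of_mem hj))

theorem det (hδ : δ =O[l] (fun _ => (1 : ℝ))) {n : Type*} [Fintype n] [DecidableEq n]
    {f g : n → n → Ω → ℂ} (h : ∀ i j, Approx l δ (f i j) (g i j)) :
    Approx l δ (fun ω => (of fun i j => f i j ω).det) fun ω => (of fun i j => g i j ω).det := by
  simp only [det_apply', of_apply]
  exact sum fun σ _ => (const _).mul hδ (prod hδ fun i _ => h _ _)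

theorem schur (hδ : δ =O[l] (fun _ => (1 : ℝ))) {x z : Ω → ℕ → ℂ} {k : ℕ}
    (h : ∀ j, 1 ≤ j → j ≤ k → Approx l δ (x · j) (z · j)) :
    Approx l δ (fun ω => schur (x ω) k) fun ω => schur (z ω) k := by
  induction k using Nat.strong_induction_on with
  | _ k ih =>
    cases k with
    | zero => simpa only [schur_zero] using const 1
    | succ k =>
      have e : ∀ x : ℕ → ℂ, KPLump.schur x (k + 1) = ((k : ℂ) + 1)⁻¹ *
          ∑ j ∈ Finset.range (k + 1), ((j : ℂ) + 1) * x (j + 1) * KPLump.schur x (k - j) := by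
        intro x
        rw [← succ_mul_schur_succ, inv_mul_cancel_left₀ (by exact_mod_cast Nat.succ_ne_zero k)]
      simp only [e]
      refine (const _).mul hδ (sum fun j hj => ?_)
      have := Finset.mem_range.1 hj
      exact ((const _).mul hδ (h _ (by omega) (by omega))).mul hδ
        (ih _ (by omega) fun i h1 h2 => h i h1 (by omega))

end Approx

end Approx

/-! ### Expansion of the determinant of a product -/

theorem det_sum_mul {n R : Type*} [Fintype n] [DecidableEq n] [CommRing R] (s : Finset ℕ)
    (u : n → ℕ → R) (w : ℕ → n → R) :
    (of fun i j => ∑ ν ∈ s, u i ν * w ν j).det =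
      ∑ φ ∈ Fintype.piFinset fun _ : n => s,
        (∏ i, u i (φ i)) * (of fun i j => w (φ i) j).det := by
  have h := (detRowAlternating (R := R) (n := n)).toMultilinearMap.map_sum_finset
    (fun i ν => u i ν • w ν) fun _ => s
  have e : (of fun i j => ∑ ν ∈ s, u i ν * w ν j) = fun i => ∑ ν ∈ s, u i ν • w ν := by
    ext i j
    simp [Finset.sum_apply]
  rw [e]
  refine h.trans (Finset.sum_congr rfl fun φ _ => ?_)
  exact (detRowAlternating (R := R) (n := n)).toMultilinearMap.map_smul_univ
    (fun i => u i (φ i)) fun i => w (φ i)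

/-- Distinct natural numbers, not all of them below their number `N`, have a sum larger than
`0 + 1 + ⋯ + (N - 1)`. -/
theorem sum_range_lt_sum_of_injective {N : ℕ} {φ : Fin N → ℕ} (hφ : Function.Injective φ)
    (h : ∃ i, N ≤ φ i) : ∑ ν ∈ Finset.range N, ν < ∑ i, φ i := by
  classical
  set S := Finset.univ.image φ with hS
  have hcard : S.card = (Finset.range N).card := by
    rw [hS, Finset.card_image_of_injective _ hφ]
    simp
  have hsum : ∑ i, φ i = ∑ ν ∈ S, ν := by
    rw [hS, Finset.sum_image fun _ _ _ _ h => hφ h]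
  have hk := Finset.card_sdiff_comm hcard
  rw [hsum, ← Finset.sum_sdiff_lt_sum_sdiff]
  have h1 : (S \ Finset.range N).card • N ≤ ∑ ν ∈ S \ Finset.range N, ν :=
    Finset.card_nsmul_le_sum _ _ _ fun ν hν => by simpa using (Finset.mem_sdiff.1 hν).2
  refine lt_of_lt_of_le ?_ h1
  rw [hk, smul_eq_mul, ← Finset.sum_const_nat fun _ _ => rfl]
  refine Finset.sum_lt_sum_of_nonempty ?_ fun ν hν => by simpa using (Finset.mem_sdiff.1 hν).1
  rw [← Finset.card_pos, ← hk, Finset.card_pos]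
  obtain ⟨i, hi⟩ := h
  exact ⟨φ i, by simp [hS, hi]⟩

/-- The choices of distinct exponents below `m`, one for each row, not all of them below `N`. -/
noncomputable def correctionIndex (N m : ℕ) : Finset (Fin N → ℕ) :=
  open Classical in
  ((Fintype.piFinset fun _ => Finset.range m) \ Fintype.piFinset fun _ => Finset.range N).filter
    Function.Injective

/-- The correction term of `det_eq_leading_add`. The exponents of `η` do not truncate, by
`sum_range_lt_sum_of_injective`. -/
noncomputable def correction {R : Type*} [CommRing R] (N m : ℕ) (η : R) (a b : Fin N → ℕ → R) : R :=
  ∑ φ ∈ correctionIndex N m, η ^ (∑ i, φ i - (∑ ν ∈ Finset.range N, ν + 1)) *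
    ((∏ i, a i (φ i)) * (of fun i j => b j (φ i)).det)

/-- Leading term, in powers of `η`, of the determinant of `∑_ν η ^ ν a_{i,ν} b_{j,ν}`: by
multilinearity the determinant is a sum over choices of distinct exponents `ν`, and the least
total exponent is attained exactly by the choices from `0, …, N - 1`. -/
theorem det_eq_leading_add {R : Type*} [CommRing R] {N m : ℕ} (hm : N ≤ m) (η : R)
    (a b : Fin N → ℕ → R) :
    (of fun i j => ∑ ν ∈ Finset.range m, η ^ ν * a i ν * b j ν).det =
      η ^ (∑ ν ∈ Finset.range N, ν) *
        ((of fun i j : Fin N => a i j).det * (of fun i j : Fin N => b i j).det +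
          η * correction N m η a b) := by
  classical
  have hdet : ∀ φ : Fin N → ℕ, (of fun i j => η ^ φ i * b j (φ i)).det =
      η ^ (∑ i, φ i) * (of fun i j => b j (φ i)).det := by
    intro φ
    rw [← Finset.prod_pow_eq_pow_sum]
    exact det_mul_column (fun i => η ^ φ i) (of fun i j => b j (φ i))
  have expand : ∀ s : Finset ℕ, (of fun i j => ∑ ν ∈ s, η ^ ν * a i ν * b j ν).det =
      ∑ φ ∈ Fintype.piFinset fun _ : Fin N => s,
        η ^ (∑ i, φ i) * ((∏ i, a i (φ i)) * (of fun i j => b j (φ i)).det) := by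
    intro s
    have e : ∀ i j, ∑ ν ∈ s, η ^ ν * a i ν * b j ν = ∑ ν ∈ s, a i ν * (η ^ ν * b j ν) :=
      fun i j => Finset.sum_congr rfl fun ν _ => by ring
    simp only [e]
    rw [det_sum_mul s a fun ν j => η ^ ν * b j ν]
    refine Finset.sum_congr rfl fun φ _ => ?_
    rw [hdet]
    ring
  have lead : (of fun i j => ∑ ν ∈ Finset.range N, η ^ ν * a i ν * b j ν).det =
      η ^ (∑ ν ∈ Finset.range N, ν) *
        ((of fun i j : Fin N => a i j).det * (of fun i j : Fin N => b i j).det) := by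
    have e : (of fun i j => ∑ ν ∈ Finset.range N, η ^ ν * a i ν * b j ν) =
        (of fun i j : Fin N => a i j) * diagonal (fun j : Fin N => η ^ (j : ℕ)) *
          (of fun i j : Fin N => b i j)ᵀ := by
      ext i j
      rw [mul_apply, of_apply, Finset.sum_range]
      refine Finset.sum_congr rfl fun ν _ => ?_
      rw [mul_diagonal, transpose_apply, of_apply, of_apply]
      ring
    rw [e, det_mul, det_mul, det_transpose, det_diagonal, Finset.prod_pow_eq_pow_sum,
      Finset.sum_range fun ν => ν]
    ring
  have hsub : (Fintype.piFinset fun _ : Fin N => Finset.range N) ⊆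
      Fintype.piFinset fun _ : Fin N => Finset.range m :=
    Fintype.piFinset_subset _ _ fun _ => Finset.range_subset_range.2 hm
  rw [expand, ← Finset.sum_sdiff hsub, ← expand, lead, mul_add, add_comm]
  congr 1
  rw [correction, Finset.mul_sum, Finset.mul_sum, correctionIndex, Finset.sum_filter]
  refine Finset.sum_congr rfl fun φ hφ => ?_
  split_ifs with hinj
  · have hlt := sum_range_lt_sum_of_injective hinj (by
      have := (Finset.mem_sdiff.1 hφ).2
      simpa [Fintype.mem_piFinset] using this)
    obtain ⟨d, hd⟩ := Nat.exists_eq_add_of_le (Nat.succ_le_of_lt hlt)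
    rw [hd, Nat.succ_eq_add_one, Nat.add_sub_cancel_left]
    ring
  · rw [Function.Injective] at hinj
    push Not at hinj
    obtain ⟨i, j, hij, hne⟩ := hinj
    rw [det_zero_of_row_eq hne (by ext k; simp [hij])]
    simp

/-! ### Scaled variables -/

theorem cubeRoot_pow_three (r : ℝ) : cubeRoot r ^ 3 = r := by
  have h : (|r| ^ (1 / 3 : ℝ)) ^ 3 = |r| := by
    rw [← Real.rpow_natCast, ← Real.rpow_mul (abs_nonneg r)]
    norm_num
  rw [cubeRoot, mul_pow, h]
  rcases lt_trichotomy r 0 with hr | rfl | hr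
  · rw [Real.sign_of_neg hr, abs_of_neg hr]; ring
  · simp
  · rw [Real.sign_of_pos hr, abs_of_pos hr]; ring

/-- The parameters of the scaled problem: a real scale `μ` with `t = -μ³ / 3`, the scaled position
`z` with `x + 3t + 2iy = μ z`, the coefficients `b k = a_{2k+1}`, and the shift `c` of the first
time (which is `n` for `x⁺` and `-n` for `x⁻`). -/
structure ScaledParam where
  c : ℂ
  μ : ℝ
  b : ℕ → ℂ
  z : ℂ

namespace ScaledParam

/-- The involution that exchanges the data of `x⁺` and of `x⁻`. -/
noncomputable def bar (ω : ScaledParam) : ScaledParam where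
  c := -conj ω.c
  μ := ω.μ
  b k := conj (ω.b k)
  z := conj ω.z

/-- The scaled times `μ ^ (-j) x_j`, as functions of `μ⁻¹`. The exponents `j - 1` and `j - 3` are
natural numbers; for `j = 1` the truncated power has the coefficient `0`. -/
noncomputable def time (ω : ScaledParam) (j : ℕ) : ℂ :=
  if Odd j then
    (ω.z.re * (ω.μ : ℂ)⁻¹ ^ (j - 1) + 2 ^ (j - 1) * Complex.I * ω.z.im * (ω.μ : ℂ)⁻¹ ^ (j - 1) -
        (3 ^ j - 3) / 3 * (ω.μ : ℂ)⁻¹ ^ (j - 3)) / (j.factorial : ℂ) +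
      (if j = 1 then ω.c else ω.b ((j - 1) / 2)) * (ω.μ : ℂ)⁻¹ ^ j
  else 0

/-- The scaled value `μ ^ (-(2i+1-ν)) S_{2i+1-ν}(x + ν s)`, which is `0` if `2i+1 < ν`. -/
noncomputable def entry (ω : ScaledParam) (i ν : ℕ) : ℂ :=
  if ν ≤ 2 * i + 1 then
    schur (fun l => ω.time l + ν * sCoeff l * (ω.μ : ℂ)⁻¹ ^ l) (2 * i + 1 - ν)
  else 0

/-- The determinant `σ_n` up to sign and divided by `4 ^ (-N(N-1)/2) μ ^ (N(N+1))`. -/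
noncomputable def sigmaHat (N : ℕ) (ω : ScaledParam) : ℂ :=
  (of fun i j : Fin N => ω.entry i j).det * (of fun i j : Fin N => ω.bar.entry i j).det +
    (ω.μ : ℂ)⁻¹ ^ 2 / 4 * correction N (2 * N) ((ω.μ : ℂ)⁻¹ ^ 2 / 4)
      (fun i ν => ω.entry i ν) (fun i ν => ω.bar.entry i ν)

end ScaledParam

theorem xPlus_eq_pow_mul_time {n : ℕ} {x y t : ℝ} {a : ℕ → ℂ} {μ : ℝ} {z : ℂ} (hμ : μ ≠ 0)
    (ht : μ ^ 3 = -3 * t) (hz : (x + 3 * t + 2 * Complex.I * y : ℂ) = μ * z) (j : ℕ) :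
    xPlus n (x - 3 * t) y t a j = (μ : ℂ) ^ j * ScaledParam.time ⟨n, μ, a, z⟩ j := by
  have hμ' : (μ : ℂ) ≠ 0 := by exact_mod_cast hμ
  have hre : (x : ℂ) + 3 * t = μ * z.re := by
    have := congrArg Complex.re hz
    simp at this
    exact_mod_cast this
  have him : 2 * (y : ℂ) = μ * z.im := by
    have := congrArg Complex.im hz
    simp at this
    exact_mod_cast this
  have ht' : (t : ℂ) = -(μ : ℂ) ^ 3 / 3 := by
    have : t = -μ ^ 3 / 3 := by linarith
    rw [this]
    push_cast
    ring
  rw [xPlus, ScaledParam.time]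
  split_ifs with hj h1
  · subst h1
    push_cast
    field_simp
    simp
    linear_combination hre + Complex.I * him
  · have h3 : 3 ≤ j := by
      obtain ⟨k, rfl⟩ := hj
      omega
    have e : ∀ m ≤ j, (μ : ℂ) ^ j * (μ : ℂ)⁻¹ ^ (j - m) = (μ : ℂ) ^ m := by
      intro m hm
      nth_rw 1 [← Nat.sub_add_cancel hm]
      rw [pow_add, mul_right_comm, ← mul_pow, mul_inv_cancel₀ hμ', one_pow, one_mul]
    have e2 : (2 : ℂ) ^ j = 2 * 2 ^ (j - 1) := by
      rw [← pow_succ', Nat.sub_add_cancel (by omega)]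
    have e0 := e 0 (by omega)
    rw [Nat.sub_zero, pow_zero] at e0
    rw [mul_add, ← mul_div_assoc, mul_left_comm _ (a _), e0, mul_one]
    congr 2
    push_cast
    linear_combination hre + Complex.I * 2 ^ (j - 1) * him + (3 ^ j - 3) * ht' +
      Complex.I * y * e2 - (z.re + 2 ^ (j - 1) * Complex.I * z.im) * e 1 (by omega) +
      (3 ^ j - 3) / 3 * e 3 h3
  · simp

theorem xMinus_eq_pow_mul_time {n : ℕ} {x y t : ℝ} {a : ℕ → ℂ} {μ : ℝ} {z : ℂ} (hμ : μ ≠ 0)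
    (ht : μ ^ 3 = -3 * t) (hz : (x + 3 * t + 2 * Complex.I * y : ℂ) = μ * z) (j : ℕ) :
    xMinus n (x - 3 * t) y t a j =
      (μ : ℂ) ^ j * ScaledParam.time (ScaledParam.bar ⟨n, μ, a, z⟩) j := by
  have h : ∀ j, xMinus n (x - 3 * t) y t a j = conj (xPlus n (x - 3 * t) y t a j) -
      if j = 1 then 2 * (n : ℂ) else 0 := by
    intro j
    rw [xMinus, xPlus]
    split_ifs with hj h1
    · simp [map_ofNat]
      ring
    · simp [map_ofNat]
      ring
    · subst j
      exact absurd odd_one hj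
    · simp
  have hμ' : (μ : ℂ) ≠ 0 := by exact_mod_cast hμ
  rw [h, xPlus_eq_pow_mul_time hμ ht hz]
  simp only [ScaledParam.time, ScaledParam.bar]
  split_ifs with hj h1
  · subst h1
    simp
    field_simp
    ring
  · simp [map_ofNat]
  · subst j
    exact absurd odd_one hj
  · simp

theorem tau_eq_pow_mul_sum {N n : ℕ} {x y t : ℝ} {a : ℕ → ℂ} {μ : ℝ} {z : ℂ} (hμ : μ ≠ 0)
    (ht : μ ^ 3 = -3 * t) (hz : (x + 3 * t + 2 * Complex.I * y : ℂ) = μ * z) (i j : Fin N) :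
    tau n (x - 3 * t) y t a (2 * (i : ℕ) + 1) (2 * (j : ℕ) + 1) =
      (-1) ^ n * ((μ : ℂ) ^ (2 * (i : ℕ) + 1) * ((μ : ℂ) ^ (2 * (j : ℕ) + 1) *
        ∑ ν ∈ Finset.range (2 * N), ((μ : ℂ)⁻¹ ^ 2 / 4) ^ ν *
          ScaledParam.entry ⟨n, μ, a, z⟩ i ν * (ScaledParam.bar ⟨n, μ, a, z⟩).entry j ν)) := by
  have hμ' : (μ : ℂ) ≠ 0 := by exact_mod_cast hμ
  have scale : ∀ (w : ℕ → ℂ) (ω : ScaledParam) (_ : ω.μ = μ) (_ : ∀ l, w l = (μ : ℂ) ^ l * ω.time l)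
      (ν k : ℕ), schur (fun l => w l + (ν : ℂ) * (sCoeff l : ℂ)) k =
        (μ : ℂ) ^ k * schur (fun l => ω.time l + ν * sCoeff l * (ω.μ : ℂ)⁻¹ ^ l) k := by
    intro w ω hω hw ν k
    rw [← schur_pow_mul]
    congr 1
    funext l
    rw [hw, hω, mul_add, mul_left_comm, ← mul_pow, mul_inv_cancel₀ hμ', one_pow, mul_one]
  have hsub : Finset.range (min (2 * (i : ℕ) + 1) (2 * (j : ℕ) + 1) + 1) ⊆
      Finset.range (2 * N) := Finset.range_subset_range.2 (by omega)
  rw [tau, Finset.mul_sum (Finset.range (2 * N)), Finset.mul_sum (Finset.range (2 * N))]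
  congr 1
  refine (Finset.sum_congr rfl fun ν hν => ?_).trans (Finset.sum_subset hsub fun ν _ hν => ?_)
  · have hν' := Finset.mem_range.1 hν
    rw [scale _ ⟨n, μ, a, z⟩ rfl (xPlus_eq_pow_mul_time hμ ht hz),
      scale _ (ScaledParam.bar ⟨n, μ, a, z⟩) rfl (xMinus_eq_pow_mul_time hμ ht hz),
      ScaledParam.entry, ScaledParam.entry, if_pos (by omega), if_pos (by omega)]
    have e : ∀ k, ν ≤ k → (μ : ℂ) ^ (k - ν) = μ ^ k * (μ : ℂ)⁻¹ ^ ν := by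
      intro k hk
      rw [pow_sub₀ _ hμ' hk, inv_pow]
    rw [e _ (by omega), e _ (by omega), div_pow, ← pow_mul, mul_comm 2 ν, pow_mul, sq]
    ring
  · rw [Finset.mem_range] at hν
    by_cases h : ν ≤ 2 * (i : ℕ) + 1
    · rw [ScaledParam.entry, ScaledParam.entry, if_neg (by omega : ¬ν ≤ 2 * (j : ℕ) + 1),
        mul_zero, mul_zero, mul_zero]
    · rw [ScaledParam.entry, if_neg h, mul_zero, zero_mul, mul_zero, mul_zero]

theorem two_mul_sum_range_add (N : ℕ) :
    2 * ∑ ν ∈ Finset.range N, ν + N * (N + 1) = N ^ 2 + N ^ 2 := by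
  induction N with
  | zero => simp
  | succ N ih => rw [Finset.sum_range_succ]; linarith

theorem sum_odd (N : ℕ) : ∑ i : Fin N, (2 * (i : ℕ) + 1) = N ^ 2 := by
  rw [← Finset.sum_range fun i => 2 * i + 1]
  induction N with
  | zero => simp
  | succ N ih => rw [Finset.sum_range_succ, ih]; ring

theorem sigma_eq_mul_sigmaHat {N n : ℕ} {x y t : ℝ} {a : ℕ → ℂ} {μ : ℝ} {z : ℂ} (hμ : μ ≠ 0)
    (ht : μ ^ 3 = -3 * t) (hz : (x + 3 * t + 2 * Complex.I * y : ℂ) = μ * z) :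
    sigma N n (x - 3 * t) y t a =
      (-1) ^ (n * N) * ((μ : ℂ) ^ (N * (N + 1)) * (1 / 4) ^ (∑ ν ∈ Finset.range N, ν) *
        ScaledParam.sigmaHat N ⟨n, μ, a, z⟩) := by
  have hμ' : (μ : ℂ) ≠ 0 := by exact_mod_cast hμ
  have e : (of fun i j : Fin N => tau n (x - 3 * t) y t a (2 * (i : ℕ) + 1) (2 * (j : ℕ) + 1)) =
      (-1 : ℂ) ^ n • of fun i j : Fin N => (μ : ℂ) ^ (2 * (i : ℕ) + 1) *
        (of fun i j : Fin N => (μ : ℂ) ^ (2 * (j : ℕ) + 1) *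
          (of fun i j : Fin N => ∑ ν ∈ Finset.range (2 * N), ((μ : ℂ)⁻¹ ^ 2 / 4) ^ ν *
            ScaledParam.entry ⟨n, μ, a, z⟩ i ν * (ScaledParam.bar ⟨n, μ, a, z⟩).entry j ν) i j)
              i j := by
    ext i j
    rw [of_apply, tau_eq_pow_mul_sum hμ ht hz]
    rfl
  rw [sigma, e, det_smul, det_mul_column, det_mul_row, Finset.prod_pow_eq_pow_sum, sum_odd,
    det_eq_leading_add (by omega) _ (fun i ν => ScaledParam.entry ⟨n, μ, a, z⟩ i ν)
      (fun i ν => (ScaledParam.bar ⟨n, μ, a, z⟩).entry i ν), Fintype.card_fin, ← pow_mul,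
    ← mul_assoc ((μ : ℂ) ^ N ^ 2), ← mul_assoc ((μ : ℂ) ^ N ^ 2 * _), ← pow_add,
    ← two_mul_sum_range_add, div_eq_mul_one_div, mul_pow, ← pow_mul, pow_add, inv_pow]
  congr 1
  have : (μ : ℂ) ^ (2 * ∑ ν ∈ Finset.range N, ν) ≠ 0 := pow_ne_zero _ hμ'
  rw [ScaledParam.sigmaHat]
  field_simp

/-! ### Asymptotics of the determinants -/

namespace ScaledParam

/-- The range of parameters over which the asymptotics are uniform. -/
def region (N : ℕ) (R : ℝ) : Set ScaledParam :=
  {ω | ‖ω.c‖ ≤ 1 ∧ 1 ≤ |ω.μ| ∧ (∀ k ∈ Finset.Icc 1 (N - 1), ‖ω.b k‖ ≤ |ω.μ| ^ (2 * k)) ∧ ‖ω.z‖ ≤ R}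

/-- The small parameter `|μ|⁻¹`. -/
noncomputable def small (ω : ScaledParam) : ℝ := |ω.μ|⁻¹

variable {N : ℕ} {R : ℝ}

theorem bar_mem_region {ω : ScaledParam} (h : ω ∈ region N R) : ω.bar ∈ region N R := by
  simpa [region, bar] using h

theorem tendsto_bar : Tendsto bar (𝓟 (region N R)) (𝓟 (region N R)) :=
  tendsto_principal_principal.2 fun _ => bar_mem_region

theorem small_le_one {ω : ScaledParam} (h : ω ∈ region N R) : small ω ≤ 1 :=
  inv_le_one_of_one_le₀ h.2.1

theorem small_nonneg (ω : ScaledParam) : 0 ≤ small ω := inv_nonneg.2 (abs_nonneg _)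

theorem small_isBigO_one : small =O[𝓟 (region N R)] fun _ => (1 : ℝ) :=
  isBigO_principal.2 ⟨1, fun ω h => by
    simpa [abs_of_nonneg (small_nonneg ω)] using small_le_one h⟩

theorem inv_pow_isBigO {k : ℕ} (hk : k ≠ 0) :
    (fun ω : ScaledParam => (ω.μ : ℂ)⁻¹ ^ k) =O[𝓟 (region N R)] small :=
  isBigO_principal.2 ⟨1, fun ω h => by
    have h1 : ‖(ω.μ : ℂ)⁻¹ ^ k‖ = small ω ^ k := by simp [small]
    rw [h1, Real.norm_of_nonneg (small_nonneg ω), one_mul]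
    exact pow_le_of_le_one (small_nonneg ω) (small_le_one h) hk⟩

theorem inv_isBigO : (fun ω : ScaledParam => (ω.μ : ℂ)⁻¹) =O[𝓟 (region N R)] small := by
  simpa using inv_pow_isBigO (N := N) (R := R) one_ne_zero

theorem z_isBigO : z =O[𝓟 (region N R)] fun _ => (1 : ℝ) :=
  isBigO_principal.2 ⟨R, fun ω h => by simpa using h.2.2.2⟩

theorem re_isBigO : (fun ω : ScaledParam => (ω.z.re : ℂ)) =O[𝓟 (region N R)] fun _ => (1 : ℝ) :=
  (IsBigO.of_norm_le fun ω => by simpa using Complex.abs_re_le_norm ω.z).trans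
    (z_isBigO (N := N) (R := R)).norm_left

theorem im_isBigO : (fun ω : ScaledParam => (ω.z.im : ℂ)) =O[𝓟 (region N R)] fun _ => (1 : ℝ) :=
  (IsBigO.of_norm_le fun ω => by simpa using Complex.abs_im_le_norm ω.z).trans
    (z_isBigO (N := N) (R := R)).norm_left

theorem c_isBigO : c =O[𝓟 (region N R)] fun _ => (1 : ℝ) :=
  isBigO_principal.2 ⟨1, fun ω h => by simpa using h.1⟩

theorem b_mul_inv_pow_isBigO {k : ℕ} (hk : k ∈ Finset.Icc 1 (N - 1)) :
    (fun ω : ScaledParam => ω.b k * (ω.μ : ℂ)⁻¹ ^ (2 * k + 1)) =O[𝓟 (region N R)] small :=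
  isBigO_principal.2 ⟨1, fun ω h => by
    have hμ : 0 < |ω.μ| := zero_lt_one.trans_le h.2.1
    have h1 : ‖ω.b k * (ω.μ : ℂ)⁻¹ ^ (2 * k + 1)‖ = ‖ω.b k‖ * (|ω.μ|⁻¹ ^ (2 * k) * |ω.μ|⁻¹) := by
      simp [pow_succ]
    rw [h1, Real.norm_of_nonneg (small_nonneg ω), one_mul, small]
    calc ‖ω.b k‖ * (|ω.μ|⁻¹ ^ (2 * k) * |ω.μ|⁻¹)
        ≤ |ω.μ| ^ (2 * k) * (|ω.μ|⁻¹ ^ (2 * k) * |ω.μ|⁻¹) := by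
          have := h.2.2.1 k hk
          gcongr
      _ = |ω.μ|⁻¹ := by
          rw [← mul_assoc, ← mul_pow, mul_inv_cancel₀ hμ.ne', one_pow, one_mul]⟩

theorem approx_time (ν : ℂ) {j : ℕ} (hj1 : 1 ≤ j) (hj : j < 2 * N) :
    Approx (𝓟 (region N R)) small
      (fun ω => ω.time j + ν * sCoeff j * (ω.μ : ℂ)⁻¹ ^ j) fun ω => yvSeq ω.z j := by
  have one_mul' : ∀ {f g : ScaledParam → ℂ}, f =O[𝓟 (region N R)] (fun _ => (1 : ℝ)) →
      g =O[𝓟 (region N R)] small → (fun ω => f ω * g ω) =O[𝓟 (region N R)] small := by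
    intro f g hf hg
    simpa using hf.mul hg
  have hs : (fun ω : ScaledParam => ν * sCoeff j * (ω.μ : ℂ)⁻¹ ^ j) =O[𝓟 (region N R)] small :=
    (inv_pow_isBigO (by omega)).const_mul_left _
  constructor
  · simp only [yvSeq, time]
    by_cases hodd : Odd j
    · simp only [if_pos hodd]
      by_cases h1 : j = 1
      · subst h1
        refine ((one_mul' c_isBigO (inv_pow_isBigO one_ne_zero)).add hs).congr_left fun ω => ?_
        simp
        linear_combination -Complex.re_add_im ω.z
      · simp only [if_neg h1]
        have hb : (fun ω : ScaledParam => ω.b ((j - 1) / 2) * (ω.μ : ℂ)⁻¹ ^ j)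
            =O[𝓟 (region N R)] small := by
          obtain ⟨k, rfl⟩ := hodd
          have := b_mul_inv_pow_isBigO (N := N) (R := R) (k := k) (by simp; omega)
          simpa using this
        have hz : (fun ω : ScaledParam => ((j.factorial : ℂ)⁻¹ *
            (ω.z.re + 2 ^ (j - 1) * Complex.I * ω.z.im)) * (ω.μ : ℂ)⁻¹ ^ (j - 1))
              =O[𝓟 (region N R)] small :=
          one_mul' ((re_isBigO.add (im_isBigO.const_mul_left _)).const_mul_left _)
            (inv_pow_isBigO (by omega))
        by_cases h3 : j = 3
        · subst h3
          refine ((hz.add hb).add hs).congr_left fun ω => ?_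
          simp [Nat.factorial]
          ring
        · simp only [if_neg h3]
          have ht : (fun ω : ScaledParam => (-(j.factorial : ℂ)⁻¹ * ((3 ^ j - 3) / 3)) *
              (ω.μ : ℂ)⁻¹ ^ (j - 3)) =O[𝓟 (region N R)] small := by
            refine (inv_pow_isBigO ?_).const_mul_left _
            obtain ⟨k, rfl⟩ := hodd
            omega
          refine (((hz.add ht).add hb).add hs).congr_left fun ω => ?_
          ring
    · have h1 : j ≠ 1 := by rintro rfl; exact hodd odd_one
      have h3 : j ≠ 3 := by rintro rfl; exact hodd (by decide)
      simpa [hodd, h1, h3] using hs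
  · simp only [yvSeq]
    split_ifs
    · exact z_isBigO
    · exact isBigO_const_const _ one_ne_zero _
    · exact isBigO_const_const _ one_ne_zero _

theorem approx_entry {i : ℕ} (hi : i < N) (ν : ℕ) :
    Approx (𝓟 (region N R)) small (fun ω => ω.entry i ν)
      fun ω => (yvSchur 1 (2 * (i : ℤ) + 1 - ν)).eval ω.z := by
  by_cases h : ν ≤ 2 * i + 1
  · have e : 2 * (i : ℤ) + 1 - ν = ((2 * i + 1 - ν : ℕ) : ℤ) := by omega
    simp only [entry, if_pos h, e, eval_yvSchur]
    exact Approx.schur small_isBigO_one fun j h1 h2 => approx_time ν h1 (by omega)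
  · simp only [entry, if_neg h]
    rw [yvSchur_of_neg (by omega)]
    simpa using Approx.const 0

theorem approx_bar {a b : ScaledParam → ℂ}
    (h : Approx (𝓟 (region N R)) small a b) :
    Approx (𝓟 (region N R)) small (fun ω => a ω.bar) fun ω => b ω.bar :=
  ⟨h.1.comp_tendsto tendsto_bar, h.2.comp_tendsto tendsto_bar⟩

theorem approx_det_entry : Approx (𝓟 (region N R)) small
    (fun ω => (of fun i j : Fin N => ω.entry i j).det) fun ω => (yvDet N).eval ω.z := by
  have h := Approx.det (l := 𝓟 (region N R)) small_isBigO_one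
    fun i j : Fin N => approx_entry i.2 (j : ℕ)
  convert h using 2 with ω
  rw [yvDet_eval_eq]
  congr 1
  ext i j
  simp only [of_apply, iterate_derivative_yvSchur]
  congr 2

theorem correction_isBigO : (fun ω => correction N (2 * N) ((ω.μ : ℂ)⁻¹ ^ 2 / 4)
    (fun i ν => ω.entry i ν) (fun i ν => ω.bar.entry i ν)) =O[𝓟 (region N R)] fun _ => (1 : ℝ) := by
  refine IsBigO.fun_sum fun φ _ => ?_
  have hη : (fun ω : ScaledParam => (ω.μ : ℂ)⁻¹ ^ 2 / 4) =O[𝓟 (region N R)] fun _ => (1 : ℝ) := by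
    have := ((inv_pow_isBigO (N := N) (R := R) two_ne_zero).trans
      small_isBigO_one).const_mul_left 4⁻¹
    exact this.congr_left fun ω => by ring
  have h := ((Approx.prod (s := Finset.univ) small_isBigO_one fun (i : Fin N) _ =>
    approx_entry (N := N) (R := R) i.2 (φ i)).mul small_isBigO_one (Approx.det small_isBigO_one
      fun i j : Fin N => approx_bar (approx_entry (N := N) (R := R) j.2 (φ i)))).left_isBigO
        small_isBigO_one
  simpa using (hη.pow (∑ i, φ i - (∑ ν ∈ Finset.range N, ν + 1))).mul h

theorem yvDet_eval_conj (z : ℂ) : (yvDet N).eval (conj z) = conj ((yvDet N).eval z) := by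
  rw [yvDet_eval_eq, yvDet_eval_eq, RingHom.map_det]
  congr 1
  ext i j
  simp only [RingHom.mapMatrix_apply, map_apply, of_apply, iterate_derivative_yvSchur]
  rcases lt_or_ge (((2 * (i : ℕ) + 1 : ℕ) : ℤ) - (j : ℕ)) 0 with h | h
  · rw [yvSchur_of_neg h]
    simp
  · obtain ⟨k, hk⟩ := Int.eq_ofNat_of_zero_le h
    rw [hk, eval_yvSchur, eval_yvSchur, map_schur]
    congr 1
    funext l
    simp only [yvSeq]
    split_ifs <;> simp [map_ofNat]

/-- The error is small of second order where `Q_N(z)` is small of first order: the terms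
`ν ≠ (0, …, N-1)` of the expansion lose one power of `μ` in each of the two factors. -/
theorem sigmaHat_sub_isBigO :
    (fun ω => sigmaHat N ω - (‖(yvDet N).eval ω.z‖ : ℂ) ^ 2) =O[𝓟 (region N R)]
      fun ω => ‖(yvDet N).eval ω.z‖ * small ω + small ω ^ 2 := by
  have h0 := approx_det_entry (N := N) (R := R)
  have h1 := approx_bar h0
  have hQ : (fun ω : ScaledParam => (yvDet N).eval ω.z) =O[𝓟 (region N R)]
      fun ω => ‖(yvDet N).eval ω.z‖ := (isBigO_refl _ _).norm_right
  have hQ' : (fun ω : ScaledParam => (yvDet N).eval ω.bar.z) =O[𝓟 (region N R)]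
      fun ω => ‖(yvDet N).eval ω.z‖ :=
    IsBigO.of_norm_le fun ω => by simp [bar, yvDet_eval_conj]
  have hsmall : (fun ω => small ω.bar) = small := by
    funext ω
    simp [small, bar]
  have h1' := h1.1
  have a1 := h0.1.mul hQ'
  have a2 := hQ.mul h1'
  have a3 := h0.1.mul h1'
  have a4 := (((inv_isBigO (N := N) (R := R)).pow 2).mul
    (correction_isBigO (N := N) (R := R))).const_mul_left 4⁻¹
  have le1 : (fun ω => ‖(yvDet N).eval ω.z‖ * small ω) =O[𝓟 (region N R)]
      fun ω => ‖(yvDet N).eval ω.z‖ * small ω + small ω ^ 2 := by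
    refine IsBigO.of_bound 1 (Eventually.of_forall fun ω => ?_)
    have := small_nonneg ω
    rw [Real.norm_of_nonneg (by positivity), Real.norm_of_nonneg (by positivity), one_mul]
    nlinarith
  have le2 : (fun ω => small ω ^ 2) =O[𝓟 (region N R)]
      fun ω => ‖(yvDet N).eval ω.z‖ * small ω + small ω ^ 2 := by
    refine IsBigO.of_bound 1 (Eventually.of_forall fun ω => ?_)
    have := small_nonneg ω
    rw [Real.norm_of_nonneg (by positivity), Real.norm_of_nonneg (by positivity), one_mul]
    have : 0 ≤ ‖(yvDet N).eval ω.z‖ * small ω := by positivity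
    linarith
  have b1 := (a1.congr_right fun ω => mul_comm _ _).trans le1
  have b2 := a2.trans le1
  have b3 := (a3.congr_right fun ω => (sq _).symm).trans le2
  have b4 := (a4.congr_right fun ω => mul_one _).trans le2
  refine (((b1.add b2).add b3).add b4).congr_left fun ω => ?_
  have hz : (yvDet N).eval ω.bar.z = conj ((yvDet N).eval ω.z) := yvDet_eval_conj ω.z
  have hn : (‖(yvDet N).eval ω.z‖ : ℂ) ^ 2 = (yvDet N).eval ω.z * (yvDet N).eval ω.bar.z := by
    rw [hz, Complex.mul_conj, Complex.normSq_eq_norm_sq]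
    push_cast
    rfl
  rw [hn, sigmaHat]
  ring

end ScaledParam

/-! ### Conclusion -/

/-- The bound comes from `u q + v q' = 1` and `q' / q = ∑ 1 / (z - zᵢ)`. -/
theorem exists_mul_le_norm_eval {q : ℂ[X]} (hq : ∀ z, q.eval z = 0 → (derivative q).eval z ≠ 0)
    (R : ℝ) : ∃ c > 0, ∀ z, ‖z‖ ≤ R → ∀ d, 0 < d → d ≤ 1 → (∀ z₀, q.IsRoot z₀ → d ≤ ‖z - z₀‖) →
      c * d ≤ ‖q.eval z‖ := by
  have hcop : IsCoprime q (derivative q) := by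
    rw [Polynomial.isCoprime_iff_aeval_ne_zero_of_isAlgClosed ℂ ℂ]
    intro z
    by_cases h : q.eval z = 0
    · exact Or.inr (by simpa using hq z h)
    · exact Or.inl (by simpa using h)
  obtain ⟨u, v, huv⟩ := hcop
  obtain ⟨A, hA⟩ := (isCompact_closedBall (0 : ℂ) R).exists_bound_of_continuousOn
    u.continuous.continuousOn
  obtain ⟨B, hB⟩ := (isCompact_closedBall (0 : ℂ) R).exists_bound_of_continuousOn
    v.continuous.continuousOn
  have hpos : 0 < |A| + |B| * q.roots.card + 1 := by positivity
  refine ⟨(|A| + |B| * q.roots.card + 1)⁻¹, inv_pos.2 hpos, fun z hz d hd hd1 hroot => ?_⟩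
  have hz' : z ∈ Metric.closedBall (0 : ℂ) R := by simpa using hz
  have hqz : q.eval z ≠ 0 := by
    intro h
    have := hroot z h
    simp at this
    linarith
  have hq0 : q ≠ 0 := by
    rintro rfl
    simp at hqz
  have hsum : ‖(q.roots.map fun w => 1 / (z - w)).sum‖ ≤ q.roots.card * d⁻¹ := by
    refine (norm_multiset_sum_le _).trans ?_
    rw [Multiset.map_map]
    refine (Multiset.sum_le_card_nsmul _ d⁻¹ ?_).trans_eq (by simp)
    intro w hw
    obtain ⟨w', hw', rfl⟩ := Multiset.mem_map.1 hw
    have := hroot w' ((mem_roots hq0).1 hw')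
    simp only [Function.comp_apply, one_div, norm_inv]
    exact inv_anti₀ hd this
  have h1 := congrArg (eval z) huv
  simp only [eval_add, eval_mul, eval_one,
    (IsAlgClosed.splits q).eval_derivative_eq_eval_mul_sum hqz] at h1
  have h2 : 1 ≤ |A| * ‖q.eval z‖ + |B| * (‖q.eval z‖ * (q.roots.card * d⁻¹)) := by
    calc (1 : ℝ) = ‖(1 : ℂ)‖ := by simp
      _ ≤ ‖u.eval z‖ * ‖q.eval z‖ +
          ‖v.eval z‖ * (‖q.eval z‖ * ‖(q.roots.map fun w => 1 / (z - w)).sum‖) := by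
        rw [← norm_mul, ← norm_mul, ← norm_mul]
        exact (congrArg norm h1.symm).le.trans (norm_add_le _ _)
      _ ≤ _ := by
        have := (hA z hz').trans (le_abs_self A)
        have := (hB z hz').trans (le_abs_self B)
        gcongr
  have hq1 := norm_pos_iff.2 hqz
  have h3 : d ≤ |A| * ‖q.eval z‖ * d + |B| * (‖q.eval z‖ * q.roots.card) := by
    have := mul_le_mul_of_nonneg_right h2 hd.le
    calc d ≤ (|A| * ‖q.eval z‖ + |B| * (‖q.eval z‖ * (q.roots.card * d⁻¹))) * d := by linarith
      _ = _ := by field_simp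
  rw [inv_mul_le_iff₀ hpos]
  have h4 : |A| * ‖q.eval z‖ * d ≤ |A| * ‖q.eval z‖ := mul_le_of_le_one_right (by positivity) hd1
  nlinarith

theorem exists_sigmaHat_bound (N : ℕ) (R : ℝ) : ∃ C > 0, ∀ ω ∈ ScaledParam.region N R,
    ‖ScaledParam.sigmaHat N ω - (‖(yvDet N).eval ω.z‖ : ℂ) ^ 2‖ ≤
      C * (‖(yvDet N).eval ω.z‖ * |ω.μ|⁻¹ + |ω.μ|⁻¹ ^ 2) := by
  obtain ⟨C, hC, h⟩ := (ScaledParam.sigmaHat_sub_isBigO (N := N) (R := R)).exists_pos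
  refine ⟨C, hC, fun ω hω => (isBigOWith_principal.1 h ω hω).trans_eq ?_⟩
  rw [Real.norm_of_nonneg]
  · rfl
  · have := ScaledParam.small_nonneg ω
    positivity

theorem norm_add_two_mul_I (u v : ℝ) :
    ‖(u + 2 * Complex.I * v : ℂ)‖ = Real.sqrt (u ^ 2 + 4 * v ^ 2) := by
  have : (u + 2 * Complex.I * v : ℂ) = u + (2 * v : ℝ) * Complex.I := by
    push_cast
    ring
  rw [this, Complex.norm_add_mul_I]
  congr 1
  ring

theorem abs_cubeRoot_pow_three (t : ℝ) : |cubeRoot (-3 * t)| ^ 3 = 3 * |t| := by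
  rw [← abs_pow, cubeRoot_pow_three, abs_mul]
  norm_num

theorem rpow_div_three_eq (t s : ℝ) : (3 * |t|) ^ (s / 3) = |cubeRoot (-3 * t)| ^ s := by
  rw [← abs_cubeRoot_pow_three, ← Real.rpow_natCast, ← Real.rpow_mul (abs_nonneg _)]
  congr 1
  push_cast
  ring

theorem one_le_abs_cubeRoot {t : ℝ} (ht : 1 ≤ |t|) : 1 ≤ |cubeRoot (-3 * t)| := by
  by_contra! h
  have := abs_cubeRoot_pow_three t
  have := pow_le_one₀ (n := 3) (abs_nonneg _) h.le
  linarith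

/-- The hypotheses on the unscaled data, with `κ = 1`, put the scaled data into the region. -/
theorem mem_region {N n : ℕ} (hn : n ≤ 1) {R x y t : ℝ} (hR : 0 < R) {a : ℕ → ℂ} {z : ℂ}
    (ht : 1 ≤ |t|) (ha : ∀ k ∈ Finset.Icc 1 (N - 1), ‖a k‖ ^ (3 / (2 * k : ℝ)) ≤ |t|)
    (hxy : Real.sqrt ((x + 3 * t) ^ 2 + 4 * y ^ 2) ≤ R * |t| ^ (1 / 3 : ℝ))
    (hz : (x + 3 * t + 2 * Complex.I * y : ℂ) = (cubeRoot (-3 * t) : ℂ) * z) :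
    (⟨n, cubeRoot (-3 * t), a, z⟩ : ScaledParam) ∈ ScaledParam.region N R := by
  have hμ := one_le_abs_cubeRoot ht
  have hle : |t| ≤ |cubeRoot (-3 * t)| ^ 3 := by
    rw [abs_cubeRoot_pow_three]
    linarith [abs_nonneg t]
  refine ⟨?_, hμ, fun k hk => ?_, ?_⟩
  · interval_cases n <;> simp
  · have hk1 : (0 : ℝ) < k := by exact_mod_cast (Finset.mem_Icc.1 hk).1
    calc ‖a k‖ = (‖a k‖ ^ (3 / (2 * k : ℝ))) ^ (2 * k / 3 : ℝ) := by
          rw [← Real.rpow_mul (norm_nonneg _)]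
          conv_lhs => rw [← Real.rpow_one ‖a k‖]
          congr 1
          field_simp
      _ ≤ (|cubeRoot (-3 * t)| ^ 3) ^ (2 * k / 3 : ℝ) := by
          refine Real.rpow_le_rpow (by positivity) ?_ (by positivity)
          exact (ha k hk).trans hle
      _ = |cubeRoot (-3 * t)| ^ (2 * k) := by
          rw [← Real.rpow_natCast, ← Real.rpow_natCast, ← Real.rpow_mul (abs_nonneg _)]
          congr 1
          push_cast
          ring
  · have h := norm_add_two_mul_I (x + 3 * t) y
    push_cast at h
    rw [hz, norm_mul, Complex.norm_real, Real.norm_eq_abs] at h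
    have h3 : |t| ^ (1 / 3 : ℝ) ≤ |cubeRoot (-3 * t)| := by
      refine (Real.rpow_le_rpow (abs_nonneg t) hle (by norm_num)).trans_eq ?_
      rw [← Real.rpow_natCast, ← Real.rpow_mul (abs_nonneg _)]
      norm_num
    have h4 : |cubeRoot (-3 * t)| * ‖z‖ ≤ |cubeRoot (-3 * t)| * R := by
      rw [h, mul_comm _ R]
      exact hxy.trans (by gcongr)
    exact le_of_mul_le_mul_left h4 (by linarith)

theorem leading_coefficient_eq (N : ℕ) (t : ℝ) (z : ℂ) :
    (2 : ℝ) ^ (-(N * (N - 1) : ℝ)) * (3 : ℝ) ^ ((N * (N + 1) : ℝ) / 3) / (yvConst N : ℝ) ^ 2 *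
        |t| ^ ((N * (N + 1) : ℝ) / 3) * ‖(yvPoly N 1).eval z‖ ^ 2 =
      cubeRoot (-3 * t) ^ (N * (N + 1)) * (1 / 4) ^ (∑ ν ∈ Finset.range N, ν) *
        ‖(yvDet N).eval z‖ ^ 2 := by
  have hc : (yvConst N : ℝ) ≠ 0 := by exact_mod_cast yvConst_ne_zero N
  have e1 : ‖(yvPoly N 1).eval z‖ = yvConst N * ‖(yvDet N).eval z‖ := by
    rw [yvPoly_eq]
    simp
  have e2 : (3 : ℝ) ^ ((N * (N + 1) : ℝ) / 3) * |t| ^ ((N * (N + 1) : ℝ) / 3) =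
      cubeRoot (-3 * t) ^ (N * (N + 1)) := by
    rw [← Real.mul_rpow (by norm_num) (abs_nonneg t), rpow_div_three_eq,
      ← (Nat.even_mul_succ_self N).pow_abs, ← Real.rpow_natCast]
    congr 1
    push_cast
    ring
  have e3 : (2 : ℝ) ^ (-(N * (N - 1) : ℝ)) = (1 / 4) ^ (∑ ν ∈ Finset.range N, ν) := by
    have h := two_mul_sum_range_add N
    have h' : (N * (N - 1) : ℝ) = ((2 * ∑ ν ∈ Finset.range N, ν : ℕ) : ℝ) := by
      have := congrArg (Nat.cast (R := ℝ)) h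
      push_cast at this ⊢
      linarith
    rw [h', Real.rpow_neg (by norm_num), Real.rpow_natCast, pow_mul, one_div, inv_pow]
    norm_num
  rw [e1, e3, ← e2]
  field_simp

/-- If `s₀` and `s₁` both agree with `P` up to a small relative error, then `(s₁ / s₀)²` is
near `1`. -/
theorem abs_div_sq_sub_one_le {P θ s₀ s₁ : ℝ} (hP : 0 < P) (hθ : θ ≤ 1 / 2)
    (h₀ : |s₀ - P| ≤ θ * P) (h₁ : |s₁ - P| ≤ θ * P) : |(s₁ / s₀) ^ 2 - 1| ≤ 24 * θ := by
  rw [abs_le] at h₀ h₁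
  have hθ0 : 0 ≤ θ := by
    by_contra! h
    nlinarith
  have hle : θ * P ≤ 1 / 2 * P := by gcongr
  have hs : P / 2 ≤ s₀ := by linarith
  have hs0 : 0 < s₀ := by linarith
  have e : (s₁ / s₀) ^ 2 - 1 = (s₁ - s₀) * (s₁ + s₀) / s₀ ^ 2 := by
    field_simp
    ring
  rw [e, abs_div, abs_mul, abs_of_pos (pow_pos hs0 2), div_le_iff₀ (pow_pos hs0 2)]
  have a1 : |s₁ - s₀| ≤ 2 * (θ * P) := abs_le.2 ⟨by linarith, by linarith⟩
  have a2 : |s₁ + s₀| ≤ 3 * P := abs_le.2 ⟨by linarith, by linarith⟩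
  calc |s₁ - s₀| * |s₁ + s₀| ≤ 2 * (θ * P) * (3 * P) := by gcongr
    _ = 24 * θ * (P / 2) ^ 2 := by ring
    _ ≤ 24 * θ * s₀ ^ 2 := by gcongr

theorem lump_eq {N : ℕ} {x y t : ℝ} {a : ℕ → ℂ} {z : ℂ} (ht : 1 ≤ |t|)
    (hz : (x + 3 * t + 2 * Complex.I * y : ℂ) = (cubeRoot (-3 * t) : ℂ) * z) :
    lump N x y t a = (‖ScaledParam.sigmaHat N ⟨(1 : ℕ), cubeRoot (-3 * t), a, z⟩‖ /
      ‖ScaledParam.sigmaHat N ⟨(0 : ℕ), cubeRoot (-3 * t), a, z⟩‖) ^ 2 - 1 := by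
  have hμ : cubeRoot (-3 * t) ≠ 0 := by
    intro h
    have := one_le_abs_cubeRoot ht
    rw [h] at this
    norm_num at this
  rw [lump, sigma_eq_mul_sigmaHat hμ (cubeRoot_pow_three _) hz,
    sigma_eq_mul_sigmaHat hμ (cubeRoot_pow_three _) hz]
  have h : ∀ n : ℕ, ‖(-1 : ℂ) ^ (n * N)‖ = 1 := fun n => by simp
  rw [norm_div, norm_mul _ (_ * ScaledParam.sigmaHat N _),
    norm_mul _ (_ * ScaledParam.sigmaHat N _),
    h, h, one_mul, one_mul, norm_mul _ (ScaledParam.sigmaHat N _),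
    norm_mul _ (ScaledParam.sigmaHat N _), mul_div_mul_left]
  exact norm_ne_zero_iff.2 (mul_ne_zero (pow_ne_zero _ (by exact_mod_cast hμ)) (by simp))

/-- The distance of `(x, y)` to the point with scaled position `z₀` is `|μ| |z - z₀|`. -/
theorem exists_exceptional_point {x y t : ℝ} {z : ℂ}
    (hz : (x + 3 * t + 2 * Complex.I * y : ℂ) = (cubeRoot (-3 * t) : ℂ) * z) (z₀ : ℂ) :
    ∃ x₀ y₀ : ℝ, (x₀ + 3 * t + 2 * Complex.I * y₀ : ℂ) = (cubeRoot (-3 * t) : ℂ) * z₀ ∧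
      Real.sqrt ((x - x₀) ^ 2 + 4 * (y - y₀) ^ 2) = |cubeRoot (-3 * t)| * ‖z - z₀‖ := by
  have h : ((cubeRoot (-3 * t) * z₀.re - 3 * t : ℝ) + 3 * t +
      2 * Complex.I * (cubeRoot (-3 * t) * z₀.im / 2 : ℝ) : ℂ) = (cubeRoot (-3 * t) : ℂ) * z₀ := by
    push_cast
    linear_combination (cubeRoot (-3 * t) : ℂ) * Complex.re_add_im z₀
  refine ⟨_, _, h, ?_⟩
  rw [← norm_add_two_mul_I, ← Real.norm_eq_abs, ← Complex.norm_real, ← norm_mul, mul_sub, ← hz, ← h]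
  congr 1
  push_cast
  ring

/-- Off the exceptional discs `|Q_N(z)|` is at least a large multiple of `|μ|⁻¹`, so that the
error terms are small relative to `|Q_N(z)| ^ 2`, uniformly with the constant `κ = 1`. -/
theorem lump_decay (N : ℕ) (hN : 1 ≤ N) (R : ℝ) (hR : 0 < R) (ε : ℝ) (hε : 0 < ε) :
    ∃ T > (0 : ℝ), ∃ M > (0 : ℝ),
      ∀ (t : ℝ) (a : ℕ → ℂ) (x y : ℝ),
        T ≤ |t| →
        (∀ k ∈ Finset.Icc 1 (N - 1), ‖a k‖ ^ (3 / (2 * k : ℝ)) ≤ |t|) →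
        Real.sqrt ((x + 3 * t) ^ 2 + 4 * y ^ 2) ≤ R * |t| ^ (1 / 3 : ℝ) →
        (∀ (z₀ : ℂ) (x₀ y₀ : ℝ), z₀ ≠ 0 → (yvPoly N 1).IsRoot z₀ →
          (x₀ + 3 * t + 2 * Complex.I * y₀ : ℂ) = (cubeRoot (-3 * t) : ℂ) * z₀ →
          M ≤ Real.sqrt ((x - x₀) ^ 2 + 4 * (y - y₀) ^ 2)) →
        ((yvPoly N 1).IsRoot 0 → M ≤ Real.sqrt ((x + 3 * t) ^ 2 + 4 * y ^ 2)) →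
        |lump N x y t a| ≤ ε := by
  obtain ⟨C, hC, hbound⟩ := exists_sigmaHat_bound N R
  obtain ⟨c, hc, hlower⟩ := exists_mul_le_norm_eval
    (fun z => derivative_yvDet_eval_ne_zero hN (α := z)) R
  -- `θ` is the relative error allowed for `σ₀` and `σ₁`; off the discs of radius `M` around the
  -- exceptional points it is at most `2C / (cM)`.
  set θ := min (1 / 2) (ε / 24) with hθ
  have hθ0 : 0 < θ := by positivity
  obtain ⟨M, hM1, hMc, hMC⟩ : ∃ M : ℝ, 1 ≤ M ∧ 1 ≤ c * M ∧ 2 * C ≤ θ * (c * M) := by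
    refine ⟨1 + 1 / c + 2 * C / (θ * c), ?_, ?_, ?_⟩
    · have : 0 ≤ 1 / c + 2 * C / (θ * c) := by positivity
      linarith
    · have : c * (1 + 1 / c + 2 * C / (θ * c)) = c + 1 + 2 * C / θ := by field_simp
      rw [this]
      have : 0 ≤ c + 2 * C / θ := by positivity
      linarith
    · have : θ * (c * (1 + 1 / c + 2 * C / (θ * c))) = θ * c + θ + 2 * C := by field_simp
      rw [this]
      have : 0 ≤ θ * c + θ := by positivity
      linarith
  refine ⟨M ^ 3, by positivity, M, by positivity, fun t a x y hT ha hxy hroots hzero => ?_⟩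
  have ht : 1 ≤ |t| := (one_le_pow₀ hM1).trans hT
  have hμ1 := one_le_abs_cubeRoot ht
  have hμ0 : 0 < |cubeRoot (-3 * t)| := zero_lt_one.trans_le hμ1
  have hMμ : M ≤ |cubeRoot (-3 * t)| := by
    refine le_of_pow_le_pow_left₀ three_ne_zero hμ0.le ?_
    rw [abs_cubeRoot_pow_three]
    linarith [abs_nonneg t]
  obtain ⟨z, hz⟩ : ∃ z : ℂ, (x + 3 * t + 2 * Complex.I * y : ℂ) = (cubeRoot (-3 * t) : ℂ) * z := by
    have : (cubeRoot (-3 * t) : ℂ) ≠ 0 := by exact_mod_cast abs_pos.1 hμ0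
    exact ⟨(x + 3 * t + 2 * Complex.I * y) / cubeRoot (-3 * t), (mul_div_cancel₀ _ this).symm⟩
  have hmem : ∀ n : ℕ, n ≤ 1 →
      (⟨n, cubeRoot (-3 * t), a, z⟩ : ScaledParam) ∈ ScaledParam.region N R :=
    fun n hn => mem_region hn hR ht ha hxy hz
  have hz1 : ‖z‖ ≤ R := (hmem 0 zero_le_one).2.2.2
  have hq : c * (M * |cubeRoot (-3 * t)|⁻¹) ≤ ‖(yvDet N).eval z‖ := by
    refine hlower z hz1 _ (by positivity) ?_ fun z₀ hz₀ => ?_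
    · rwa [← div_eq_mul_inv, div_le_one hμ0]
    · have hroot : (yvPoly N 1).IsRoot z₀ := by
        rw [yvPoly_eq]
        exact root_mul_left_of_isRoot _ hz₀
      rw [← div_eq_mul_inv, div_le_iff₀ hμ0, mul_comm]
      by_cases h0 : z₀ = 0
      · subst h0
        have h := norm_add_two_mul_I (x + 3 * t) y
        push_cast at h
        rw [hz, norm_mul, Complex.norm_real, Real.norm_eq_abs] at h
        rw [sub_zero, h]
        exact hzero hroot
      · obtain ⟨x₀, y₀, h1, h2⟩ := exists_exceptional_point hz z₀
        rw [← h2]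
        exact hroots z₀ x₀ y₀ h0 hroot h1
  set δ := |cubeRoot (-3 * t)|⁻¹ with hδ
  set Q := ‖(yvDet N).eval z‖ with hQ
  have hδ0 : 0 < δ := inv_pos.2 hμ0
  have hQδ : c * M * δ ≤ Q := by rwa [mul_assoc]
  have hδQ : δ ≤ Q := by nlinarith
  have hrel : C * (Q * δ + δ ^ 2) ≤ θ * Q ^ 2 := by
    have h1 : Q * δ + δ ^ 2 ≤ 2 * (Q * δ) := by nlinarith
    calc C * (Q * δ + δ ^ 2) ≤ C * (2 * (Q * δ)) := by gcongr
      _ = 2 * C * δ * Q := by ring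
      _ ≤ θ * (c * M) * δ * Q := by gcongr
      _ = θ * (c * M * δ) * Q := by ring
      _ ≤ θ * Q * Q := by gcongr
      _ = θ * Q ^ 2 := by ring
  have hs : ∀ n : ℕ, n ≤ 1 →
      |‖ScaledParam.sigmaHat N ⟨n, cubeRoot (-3 * t), a, z⟩‖ - Q ^ 2| ≤ θ * Q ^ 2 := by
    intro n hn
    have h1 := (hbound _ (hmem n hn)).trans hrel
    refine le_trans ?_ h1
    have h2 : ‖((Q : ℂ)) ^ 2‖ = Q ^ 2 := by
      rw [norm_pow, Complex.norm_real, Real.norm_of_nonneg (norm_nonneg _)]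
    conv_lhs => rw [← h2]
    exact abs_norm_sub_norm_le _ _
  rw [lump_eq ht hz]
  have hQ0 : 0 < Q := hδ0.trans_le hδQ
  refine (abs_div_sq_sub_one_le (pow_pos hQ0 2) (min_le_left _ _) (hs 0 zero_le_one)
    (hs 1 le_rfl)).trans ?_
  have := min_le_right (1 / 2) (ε / 24)
  linarith

theorem sigma_leading_term (N : ℕ) (R : ℝ) (hR : 0 < R) :
    ∃ K > (0 : ℝ),
      ∀ (t : ℝ) (a : ℕ → ℂ) (x y : ℝ) (z : ℂ),
        1 ≤ |t| →
        (∀ k ∈ Finset.Icc 1 (N - 1), ‖a k‖ ^ (3 / (2 * k : ℝ)) ≤ |t|) →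
        Real.sqrt ((x + 3 * t) ^ 2 + 4 * y ^ 2) ≤ R * |t| ^ (1 / 3 : ℝ) →
        (x + 3 * t + 2 * Complex.I * y : ℂ) = (cubeRoot (-3 * t) : ℂ) * z →
        ∀ n ∈ ({0, 1} : Finset ℕ),
          ‖sigma N n (x - 3 * t) y t a -
              (-1) ^ (n * N) *
                (((2 : ℝ) ^ (-(N * (N - 1) : ℝ)) * (3 : ℝ) ^ ((N * (N + 1) : ℝ) / 3) /
                    (yvConst N : ℝ) ^ 2 *
                  |t| ^ ((N * (N + 1) : ℝ) / 3) *
                  ‖(yvPoly N 1).eval z‖ ^ 2 : ℝ) : ℂ)‖ ≤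
            K * |t| ^ (((N * (N + 1) : ℝ) - 1) / 3) := by
  obtain ⟨C, hC, hbound⟩ := exists_sigmaHat_bound N R
  obtain ⟨B, hB⟩ := (isCompact_closedBall (0 : ℂ) R).exists_bound_of_continuousOn
    (yvDet N).continuous.continuousOn
  refine ⟨C * (|B| + 1) * 3 ^ (((N * (N + 1) : ℝ) - 1) / 3), by positivity,
    fun t a x y z ht ha hxy hz n hn => ?_⟩
  have hn1 : n ≤ 1 := by
    rcases Finset.mem_insert.1 hn with rfl | hn
    · exact zero_le_one
    · rw [Finset.mem_singleton.1 hn]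
  have hmem := mem_region (n := n) hn1 hR ht ha hxy hz
  have hμ1 := one_le_abs_cubeRoot ht
  have hμ0 : 0 < |cubeRoot (-3 * t)| := zero_lt_one.trans_le hμ1
  have hQ : ‖(yvDet N).eval z‖ ≤ |B| :=
    (hB z (by simpa using hmem.2.2.2)).trans (le_abs_self B)
  rw [leading_coefficient_eq, sigma_eq_mul_sigmaHat (abs_pos.1 hμ0) (cubeRoot_pow_three _) hz,
    ← mul_sub, norm_mul, norm_pow, norm_neg, norm_one, one_pow, one_mul]
  push_cast
  rw [← mul_sub, norm_mul, norm_mul, norm_pow, norm_pow, Complex.norm_real, Real.norm_eq_abs]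
  have hquarter : ‖(1 / 4 : ℂ)‖ ^ (∑ ν ∈ Finset.range N, ν) ≤ 1 :=
    pow_le_one₀ (norm_nonneg _) (by norm_num)
  have herr := hbound _ hmem
  have hδ1 : |cubeRoot (-3 * t)|⁻¹ ≤ 1 := inv_le_one_of_one_le₀ hμ1
  have hδ0 : 0 < |cubeRoot (-3 * t)|⁻¹ := inv_pos.2 hμ0
  have hpow : |cubeRoot (-3 * t)| ^ (N * (N + 1)) * |cubeRoot (-3 * t)|⁻¹ =
      3 ^ (((N * (N + 1) : ℝ) - 1) / 3) * |t| ^ (((N * (N + 1) : ℝ) - 1) / 3) := by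
    rw [← Real.mul_rpow (by norm_num) (abs_nonneg t), rpow_div_three_eq, Real.rpow_sub hμ0,
      Real.rpow_one, ← div_eq_mul_inv]
    congr 1
    rw [← Real.rpow_natCast]
    push_cast
    rfl
  have hsmall : ‖(yvDet N).eval z‖ * |cubeRoot (-3 * t)|⁻¹ + |cubeRoot (-3 * t)|⁻¹ ^ 2 ≤
      (|B| + 1) * |cubeRoot (-3 * t)|⁻¹ := by
    rw [add_mul, one_mul, sq]
    exact add_le_add (mul_le_mul_of_nonneg_right hQ hδ0.le) (mul_le_of_le_one_left hδ0.le hδ1)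
  calc _ ≤ |cubeRoot (-3 * t)| ^ (N * (N + 1)) * 1 *
        (C * ((|B| + 1) * |cubeRoot (-3 * t)|⁻¹)) := by
        gcongr
        exact herr.trans (by gcongr)
    _ = C * (|B| + 1) * (|cubeRoot (-3 * t)| ^ (N * (N + 1)) * |cubeRoot (-3 * t)|⁻¹) := by ring
    _ = _ := by rw [hpow]; ring

end KPLump

theorem mainTheorem6 (N : ℕ) (hN : 1 ≤ N) (R : ℝ) (hR : 0 < R) :
    -- decay of the lump solution away from the exceptional points
    (∀ ε : ℝ, 0 < ε → ∃ κ > (0 : ℝ), ∃ T > (0 : ℝ), ∃ M > (0 : ℝ),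
      ∀ (t : ℝ) (a : ℕ → ℂ) (x y : ℝ),
        T ≤ |t| →
        (∀ k ∈ Finset.Icc 1 (N - 1), ‖a k‖ ^ (3 / (2 * k : ℝ)) ≤ κ * |t|) →
        Real.sqrt ((x + 3 * t) ^ 2 + 4 * y ^ 2) ≤ R * |t| ^ (1 / 3 : ℝ) →
        (∀ (z₀ : ℂ) (x₀ y₀ : ℝ), z₀ ≠ 0 → (KPLump.yvPoly N 1).IsRoot z₀ →
          (x₀ + 3 * t + 2 * Complex.I * y₀ : ℂ) = (KPLump.cubeRoot (-3 * t) : ℂ) * z₀ →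
          M ≤ Real.sqrt ((x - x₀) ^ 2 + 4 * (y - y₀) ^ 2)) →
        ((KPLump.yvPoly N 1).IsRoot 0 → M ≤ Real.sqrt ((x + 3 * t) ^ 2 + 4 * y ^ 2)) →
        |KPLump.lump N x y t a| ≤ ε) ∧
    -- leading term of the determinants
    (∃ κ > (0 : ℝ), ∃ T > (0 : ℝ), ∃ K > (0 : ℝ),
      ∀ (t : ℝ) (a : ℕ → ℂ) (x y : ℝ) (z : ℂ),
        T ≤ |t| →
        (∀ k ∈ Finset.Icc 1 (N - 1), ‖a k‖ ^ (3 / (2 * k : ℝ)) ≤ κ * |t|) →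
        Real.sqrt ((x + 3 * t) ^ 2 + 4 * y ^ 2) ≤ R * |t| ^ (1 / 3 : ℝ) →
        (x + 3 * t + 2 * Complex.I * y : ℂ) = (KPLump.cubeRoot (-3 * t) : ℂ) * z →
        ∀ n ∈ ({0, 1} : Finset ℕ),
          ‖KPLump.sigma N n (x - 3 * t) y t a -
              (-1) ^ (n * N) *
                (((2 : ℝ) ^ (-(N * (N - 1) : ℝ)) * (3 : ℝ) ^ ((N * (N + 1) : ℝ) / 3) /
                    (KPLump.yvConst N : ℝ) ^ 2 *
                  |t| ^ ((N * (N + 1) : ℝ) / 3) *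
                  ‖(KPLump.yvPoly N 1).eval z‖ ^ 2 : ℝ) : ℂ)‖ ≤
            K * |t| ^ (((N * (N + 1) : ℝ) - 1) / 3)) := by
  refine ⟨fun ε hε => ⟨1, one_pos, ?_⟩, 1, one_pos, 1, one_pos, ?_⟩
  · simpa only [one_mul] using KPLump.lump_decay N hN R hR ε hε
  · simpa only [one_mul] using KPLump.sigma_leading_term N R hR
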